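/- **Setting.** Let $k\ge 1$. A $k$-distinguisher on $\mathbb N$ is an undirected $k$-hypergraph on the vertex set $\mathbb N$, i.e. a function $g:\mathbb N^k\to\{0,1\}$ invariant under permutations of its arguments, and a $k$-distinguishing class is a set $\mathcal G$ of $k$-distinguishers. For a probability distribution $p$ on $\mathbb N$ put $L_p(g)=\mathbb E_{v_{1:k}\sim p^k}[g(v_{1:k})]$, and for distributions $p_1,p_2$ put $$\mathrm{IPM}_{\mathcal G}(p_1,p_2)=\sup_{g\in\mathcal G}|L_{p_1}(g)-L_{p_2}(g)|.$$ A $\mathcal G$-discriminating algorithm with sample complexity $m(\epsilon,\delta)\in\mathbb N$ is a map $A$ that assigns to every pair of finite samples $(S_1,S_2)$ of vertices an element $g^A_S\in\mathcal G$ such that, for all $\epsilon>0$, $\delta\in(0,1)$ and all distributions $p_1,p_2$ on $\mathbb N$: if $S_1$ and $S_2$ are independent i.i.d. samples from $p_1$ and $p_2$ with $|S_1|,|S_2|>m(\epsilon,\delta)$, then with probability at least $1-\delta$ $$|L_{p_1}(g^A_S)-L_{p_2}(g^A_S)|>\mathrm{IPM}_{\mathcal G}(p_1,p_2)-\epsilon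 .$$ A class $\mathcal G$ has sample complexity at most $m(\epsilon,\delta)$ if such an algorithm exists, and it has bounded sample complexity (is discriminable) if this holds for some finite-valued function $m(\epsilon,\delta)$. **Theorem.** There is an absolute constant $C>0$ such that for every integer $k\ge 2$ there exists a $k$-distinguishing class $\mathcal G_k$ on $\mathbb N$ with the following two properties. 1. $\mathcal G_k$ has sample complexity at most some function $m(\epsilon,\delta)$ with $$m(\epsilon,\delta)\le C\,\frac{k^2+\log(1/\delta)}{\epsilon^2}\qquad\text{for all }\epsilon>0,\ \delta\in(0,1).$$ 2. For every $(k-1)$-distinguishing class $\mathcal G_{k-1}$ on $\mathbb N$ with bounded sample complexity, and every $\epsilon>0$, there are two probability distributions $p_1,p_2$ on $\mathbb N$ such that $$\mathrm{IPM}_{\mathcal G_{k-1}}(p_1,p_2)<\epsilon\qquad\text{and}\qquad \mathrm{IPM}_{\mathcal G_k}(p_1,p_2)>\tfrac14 .$$ -/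

import Mathlib

open MeasureTheory

noncomputable section

namespace GraphDiscriminator

/-- A `k`-distinguisher over the vertex set `V`: an undirected `k`-hypergraph, that is, a set of
hyperedges in `V ^ k` that is invariant under permutations of the coordinates.  Hyperedges with
repeated vertices are allowed.  A set `G : Set (Distinguisher k V)` is a `k`-distinguishing
class. -/
@[ext]
structure Distinguisher (k : ℕ) (V : Type*) where
  /-- The set of hyperedges. -/
  edges : Set (Fin k → V)
  /-- The hypergraph is undirected. -/
  symm : ∀ (π : Equiv.Perm (Fin k)) (v : Fin k → V), (v ∘ π) ∈ edges ↔ v ∈ edges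

variable {k : ℕ} {V : Type*} [MeasurableSpace V]

/-- The frequency `L_P(g) = P^k (E_g)` of an edge of `g` under the distribution `P`. -/
def freq (P : ProbabilityMeasure V) (g : Distinguisher k V) : ℝ :=
  (Measure.pi (fun _ : Fin k => (P : Measure V))).real g.edges

/-- The integral probability metric `sup_{g ∈ G} |L_{p₁}(g) - L_{p₂}(g)|`.  The quantities lie in
`[0, 1]`, so this is a genuine supremum as soon as `G` is nonempty. -/
def IPM (G : Set (Distinguisher k V)) (p₁ p₂ : ProbabilityMeasure V) : ℝ :=
  ⨆ g : G, |freq p₁ (g : Distinguisher k V) - freq p₂ (g : Distinguisher k V)|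

/-- An algorithm that receives two finite samples of vertices (of any sizes `m₁`, `m₂`) and
outputs a member of the class `G`. -/
abbrev Algorithm (G : Set (Distinguisher k V)) : Type _ :=
  (m₁ m₂ : ℕ) → (Fin m₁ → V) → (Fin m₂ → V) → G

/-- `A` is a `G`-discriminating algorithm with sample complexity `m`: whenever `S₁`, `S₂` are
independent i.i.d. samples from `p₁`, `p₂` of sizes larger than `m ε δ`, then with probability at
least `1 - δ` the output `g` satisfies `|L_{p₁}(g) - L_{p₂}(g)| > IPM_G(p₁, p₂) - ε`. -/
def IsDiscriminating (G : Set (Distinguisher k V)) (A : Algorithm G) (m : ℝ → ℝ → ℕ) : Prop :=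
  ∀ ε δ : ℝ, 0 < ε → 0 < δ → δ < 1 →
    ∀ m₁ m₂ : ℕ, m ε δ < m₁ → m ε δ < m₂ →
      ∀ p₁ p₂ : ProbabilityMeasure V,
        1 - δ ≤ ((Measure.pi (fun _ : Fin m₁ => (p₁ : Measure V))).prod
            (Measure.pi (fun _ : Fin m₂ => (p₂ : Measure V)))).real
          {S : (Fin m₁ → V) × (Fin m₂ → V) |
            IPM G p₁ p₂ - ε <
              |freq p₁ (A m₁ m₂ S.1 S.2 : Distinguisher k V) -
                freq p₂ (A m₁ m₂ S.1 S.2 : Distinguisher k V)|}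

/-- The class `G` is learnable by some discriminating algorithm with sample complexity `m`. -/
def HasSampleComplexity (G : Set (Distinguisher k V)) (m : ℝ → ℝ → ℕ) : Prop :=
  ∃ A : Algorithm G, IsDiscriminating G A m

/-- The class `G` is discriminable: its sample complexity is finite. -/
def Discriminable (G : Set (Distinguisher k V)) : Prop :=
  ∃ m : ℝ → ℝ → ℕ, HasSampleComplexity G m

end GraphDiscriminator

end

noncomputable section

namespace GraphDiscriminator

open scoped NNReal ENNReal

/-! A single hypergraph, built from Shamir's secret sharing, serves as the whole class, so property
1 holds with no samples at all. Put q = k - 1 and let F be a prime field with at least 10q² units.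
For n polynomials of degree less than q, a share vertex carries their values at one unit of F, and a
claim vertex asserts the value of one of them at 0, its secret. A claim and q shares form an edge if
some polynomial of degree less than q fits them. Both distributions give mass q/(q+1) to the shares
and 1/(q+1) to n claims; the claims are right in the first and shifted by 1 in the second. With
right claims every tuple with exactly one claim is an edge, which has probability at least 1/e. With
wrong claims interpolation forces a repeated share, which has probability at most 1/10
(`quarter_lt_freq_sub_freq`).

A q-hypergraph sees either no claim, where the two distributions agree, or fewer than q distinct
shares, which reveal nothing about the secrets (`exists_coeff_vanishing`).
`IPM_placement_le_of_restrictWeights` reduces to fixed sets of fewer than q shares, and there the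
claims X are uniform. For a fixed hypergraph, the frequencies for X and X + 1 have the same mean and
variance O(q²/n) by Efron-Stein. A discriminating algorithm draws a number of samples independent of
n, so for given sampled atoms it has boundedly many possible outputs; for large n a union bound
makes all of them fail for most X (`Discriminable.card_le_IPM_placement_lt`). A further union bound
over the sets of shares leaves good polynomials. -/

/-! ### Variance under bounded differences. -/

/-- The Efron-Stein inequality for functions with bounded differences on a finite product
space, in the division-free form `K ∑ f² ≤ (∑ f)² + K² ∑ cᵢ²` where `K = |F| ^ n`. -/
theorem efronStein_of_bounded_differences {F : Type*} [Fintype F] :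
    ∀ (n : ℕ) (c : Fin n → ℝ) (f : (Fin n → F) → ℝ),
      (∀ X i b, |f X - f (Function.update X i b)| ≤ c i) →
      (Fintype.card F : ℝ) ^ n * ∑ X, f X ^ 2 ≤
        (∑ X, f X) ^ 2 + ((Fintype.card F : ℝ) ^ n) ^ 2 * ∑ i, c i ^ 2 := by
  intro n
  induction n with
  | zero => intro c f _; simp
  | succ n ih =>
    intro c f hf
    set K : ℝ := (Fintype.card F : ℝ) ^ n with hK
    have hK0 : 0 ≤ K := by positivity
    have hsum : ∀ g : (Fin (n + 1) → F) → ℝ,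
        ∑ X, g X = ∑ b, ∑ X : Fin n → F, g (Fin.cons b X) := by
      intro g
      rw [← Fintype.sum_prod_type' (fun b (X : Fin n → F) => g (Fin.cons b X))]
      exact (Equiv.sum_comp (Fin.consEquiv (fun _ : Fin (n + 1) => F)) g).symm
    have hb : ∀ b, K * ∑ X : Fin n → F, f (Fin.cons b X) ^ 2 ≤
        (∑ X : Fin n → F, f (Fin.cons b X)) ^ 2 + K ^ 2 * ∑ i : Fin n, c i.succ ^ 2 := by
      intro b
      refine ih (fun i => c i.succ) (fun X => f (Fin.cons b X)) ?_
      intro X i b'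
      simpa [Fin.cons_update] using hf (Fin.cons b X) i.succ b'
    set s : F → ℝ := fun b => ∑ X : Fin n → F, f (Fin.cons b X) with hs
    have hdiff : ∀ b b', (s b - s b') ^ 2 ≤ K ^ 2 * c 0 ^ 2 := by
      intro b b'
      rw [← mul_pow]
      refine sq_le_sq' ?_ ?_
      all_goals
        have h1 : |s b - s b'| ≤ K * c 0 := by
          rw [hs]
          simp only
          rw [← Finset.sum_sub_distrib]
          refine (Finset.abs_sum_le_sum_abs _ _).trans ?_
          refine (Finset.sum_le_sum (g := fun _ => c 0) fun X _ => ?_).trans ?_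
          · simpa using hf (Fin.cons b X) 0 b'
          · simp [hK]
        have := abs_le.1 h1
        linarith [this.1, this.2]
    -- The variance of the fibre sums `s` is expressed through pairwise differences; a factor 1/2 in
    -- the last term is given away.
    have hpair : (Fintype.card F : ℝ) * ∑ b, s b ^ 2 ≤
        (∑ b, s b) ^ 2 + (Fintype.card F : ℝ) ^ 2 * (K ^ 2 * c 0 ^ 2) := by
      have h2 : ∑ b, ∑ b', (s b - s b') ^ 2 =
          2 * ((Fintype.card F : ℝ) * ∑ b, s b ^ 2) - 2 * (∑ b, s b) ^ 2 := by
        simp only [sub_sq, Finset.sum_add_distrib, Finset.sum_sub_distrib, Finset.sum_const,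
          Finset.card_univ, nsmul_eq_mul, ← Finset.mul_sum, ← Finset.sum_mul, mul_assoc]
        ring
      have h3 : ∑ b, ∑ b', (s b - s b') ^ 2 ≤ ∑ _b : F, ∑ _b' : F, K ^ 2 * c 0 ^ 2 :=
        Finset.sum_le_sum fun b _ => Finset.sum_le_sum fun b' _ => hdiff b b'
      simp only [Finset.sum_const, Finset.card_univ, nsmul_eq_mul] at h3
      nlinarith [sq_nonneg (Fintype.card F * K * c 0)]
    rw [hsum, hsum, Fin.sum_univ_succ, pow_succ]
    have h4 := Finset.sum_le_sum fun b (_ : b ∈ Finset.univ) => hb b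
    rw [Finset.sum_add_distrib, ← Finset.mul_sum, Finset.sum_const, Finset.card_univ,
      nsmul_eq_mul] at h4
    have h5 := mul_le_mul_of_nonneg_left h4 (Nat.cast_nonneg (α := ℝ) (Fintype.card F))
    nlinarith [h5, hpair]

/-! ### Finitely supported distributions and their products. -/

/-- The finitely supported measure that puts mass `w ω` on the point `φ ω`. -/
def mixture {Ω V : Type*} [Fintype Ω] [MeasurableSpace V] (w : Ω → ℝ≥0) (φ : Ω → V) :
    Measure V :=
  ∑ ω, (w ω : ℝ≥0∞) • Measure.dirac (φ ω)

section Mixture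

variable {Ω Ω' V V' : Type*} [Fintype Ω] [Fintype Ω'] [MeasurableSpace V] [MeasurableSpace V']

theorem mixture_apply_of_measurableSet (w : Ω → ℝ≥0) (φ : Ω → V) {s : Set V}
    (hs : MeasurableSet s) :
    mixture w φ s = ∑ ω, (w ω : ℝ≥0∞) * s.indicator 1 (φ ω) := by
  simp only [mixture, Measure.finsetSum_apply, Measure.smul_apply, Measure.dirac_apply' _ hs, smul_eq_mul]

/-- Measurable singletons make the formula valid for every set; edge sets and success events of
algorithms need not be measurable. -/
theorem mixture_real [MeasurableSingletonClass V] (w : Ω → ℝ≥0) (φ : Ω → V) (s : Set V) :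
    (mixture w φ).real s = ∑ ω, (w ω : ℝ) * s.indicator 1 (φ ω) := by
  rw [Measure.real, mixture, Measure.finsetSum_apply, ENNReal.toReal_sum]
  · refine Finset.sum_congr rfl fun ω _ => ?_
    by_cases h : φ ω ∈ s <;> simp [h]
  · intro ω _
    by_cases h : φ ω ∈ s <;> simp [h]

theorem isProbabilityMeasure_mixture {w : Ω → ℝ≥0} (hw : ∑ ω, w ω = 1) (φ : Ω → V) :
    IsProbabilityMeasure (mixture w φ) := by
  constructor
  rw [mixture_apply_of_measurableSet _ _ MeasurableSet.univ]
  simp only [Set.indicator_univ, Pi.one_apply, mul_one]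
  exact_mod_cast hw

instance isFiniteMeasure_mixture (w : Ω → ℝ≥0) (φ : Ω → V) : IsFiniteMeasure (mixture w φ) := by
  constructor
  rw [mixture_apply_of_measurableSet _ _ MeasurableSet.univ]
  simp only [Set.indicator_univ, Pi.one_apply, mul_one]
  exact ENNReal.sum_lt_top.2 fun ω _ => ENNReal.coe_lt_top

/-- I.i.d. sampling becomes sampling of atom indices. The weights do not involve `φ`, so placements
with the same weights can be compared term by term. -/
theorem pi_mixture (m : ℕ) (w : Ω → ℝ≥0) (φ : Ω → V) :
    Measure.pi (fun _ : Fin m => mixture w φ) =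
      mixture (fun t : Fin m → Ω => ∏ i, w (t i)) (fun t => φ ∘ t) := by
  classical
  refine Measure.pi_eq fun s hs => ?_
  rw [mixture_apply_of_measurableSet _ _ (MeasurableSet.univ_pi hs)]
  simp only [fun i => mixture_apply_of_measurableSet w φ (hs i)]
  rw [Finset.prod_univ_sum, Fintype.piFinset_univ]
  refine Finset.sum_congr rfl fun t _ => ?_
  rw [Finset.prod_mul_distrib, ENNReal.ofNNReal_finsetProd]
  congr 1
  by_cases h : ∀ i, φ (t i) ∈ s i
  · rw [Set.indicator_of_mem (by simpa [Set.mem_pi] using h), Finset.prod_eq_one]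
    · rfl
    · intro i _; rw [Set.indicator_of_mem (h i)]; rfl
  · rw [Set.indicator_of_notMem (by simpa [Set.mem_pi] using h)]
    push Not at h
    obtain ⟨i, hi⟩ := h
    rw [Finset.prod_eq_zero (Finset.mem_univ i)]
    rw [Set.indicator_of_notMem hi]

theorem prod_mixture (w : Ω → ℝ≥0) (φ : Ω → V) (w' : Ω' → ℝ≥0) (φ' : Ω' → V') :
    (mixture w φ).prod (mixture w' φ') =
      mixture (fun t : Ω × Ω' => w t.1 * w' t.2) (fun t => (φ t.1, φ' t.2)) := by
  refine Measure.prod_eq fun s s' hs hs' => ?_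
  rw [mixture_apply_of_measurableSet _ _ (hs.prod hs'), mixture_apply_of_measurableSet _ _ hs,
    mixture_apply_of_measurableSet _ _ hs', Finset.sum_mul_sum, Fintype.sum_prod_type]
  refine Finset.sum_congr rfl fun ω _ => Finset.sum_congr rfl fun ω' _ => ?_
  by_cases h : φ ω ∈ s <;> by_cases h' : φ' ω' ∈ s' <;> simp [h, h']

/-- The probability distribution that puts mass `w ω` on the point `φ ω`. -/
def probMixture (w : Ω → ℝ≥0) (hw : ∑ ω, w ω = 1) (φ : Ω → V) : ProbabilityMeasure V :=
  ⟨mixture w φ, isProbabilityMeasure_mixture hw φ⟩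

theorem freq_probMixture [MeasurableSingletonClass V] {k : ℕ} (w : Ω → ℝ≥0)
    (hw : ∑ ω, w ω = 1) (φ : Ω → V) (g : Distinguisher k V) :
    freq (probMixture w hw φ) g =
      ∑ t : Fin k → Ω, (∏ i, (w (t i) : ℝ)) * g.edges.indicator 1 (φ ∘ t) := by
  change (Measure.pi (fun _ : Fin k => mixture w φ)).real g.edges = _
  rw [pi_mixture, mixture_real]
  simp

end Mixture

theorem freq_mem_Icc {k : ℕ} {V : Type*} [MeasurableSpace V] (P : ProbabilityMeasure V)
    (g : Distinguisher k V) : freq P g ∈ Set.Icc (0 : ℝ) 1 :=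
  ⟨measureReal_nonneg, measureReal_le_one⟩

theorem abs_freq_sub_freq_le_one {k : ℕ} {V : Type*} [MeasurableSpace V]
    (p₁ p₂ : ProbabilityMeasure V) (g : Distinguisher k V) : |freq p₁ g - freq p₂ g| ≤ 1 := by
  have h1 := freq_mem_Icc p₁ g
  have h2 := freq_mem_Icc p₂ g
  rw [abs_le]
  constructor <;> linarith [h1.1, h1.2, h2.1, h2.2]

theorem le_IPM {k : ℕ} {V : Type*} [MeasurableSpace V] {G : Set (Distinguisher k V)}
    (p₁ p₂ : ProbabilityMeasure V) {g : Distinguisher k V} (hg : g ∈ G) :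
    |freq p₁ g - freq p₂ g| ≤ IPM G p₁ p₂ := by
  refine le_ciSup (f := fun g : G => |freq p₁ g.1 - freq p₂ g.1|) ?_ ⟨g, hg⟩
  exact ⟨1, by rintro _ ⟨g, rfl⟩; exact abs_freq_sub_freq_le_one _ _ _⟩

section Weights

variable {Ω : Type*} [Fintype Ω]

/-- Independence of the coordinates under product weights. -/
theorem sum_prod_mul_prod {q : ℕ} (w : Ω → ℝ) (g : Fin q → Ω → ℝ) :
    ∑ t : Fin q → Ω, (∏ i, w (t i)) * ∏ i, g i (t i) = ∏ i, ∑ ω, w ω * g i ω := by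
  classical
  rw [Finset.prod_univ_sum, Fintype.piFinset_univ]
  simp [Finset.prod_mul_distrib]

theorem sum_prod_mul_apply {q : ℕ} {w : Ω → ℝ} (hw : ∑ ω, w ω = 1) (g : Ω → ℝ) (j : Fin q) :
    ∑ t : Fin q → Ω, (∏ i, w (t i)) * g (t j) = ∑ ω, w ω * g ω := by
  have h := sum_prod_mul_prod w (fun i : Fin q => if i = j then g else fun _ => 1)
  rw [Finset.prod_eq_single j] at h
  · simpa [ite_apply, Finset.prod_ite_eq'] using h
  · intro i _ hij
    simp [hij, hw]
  · simp

end Weights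

/-! ### Random placements and discriminable classes. -/

/-- The placement of atoms in which the fixed atoms `R` sit at `y`, and the `i`-th of the
remaining `n` atoms chooses, according to `X i`, one of the points `l i b`. -/
def placement {R F V : Type*} {n : ℕ} (y : R → V) (l : Fin n → F → V) (X : Fin n → F) :
    R ⊕ Fin n → V :=
  Sum.elim y fun i => l i (X i)

section Concentration

variable {R F V : Type*} [Fintype R] [MeasurableSpace V] [MeasurableSingletonClass V]

/-- Moving one atom affects only the tuples that contain it, and a union bound over the `q`
coordinates bounds their weight. -/
theorem abs_freq_placement_update_le {n q : ℕ} (w : R ⊕ Fin n → ℝ≥0) (hw : ∑ ω, w ω = 1)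
    (y : R → V) (l : Fin n → F → V) (h : Distinguisher q V) (X : Fin n → F) (i : Fin n) (b : F) :
    |freq (probMixture w hw (placement y l X)) h -
      freq (probMixture w hw (placement y l (Function.update X i b))) h| ≤ q * w (Sum.inr i) := by
  classical
  have hw' : ∑ ω, (w ω : ℝ) = 1 := by exact_mod_cast hw
  rw [freq_probMixture, freq_probMixture, ← Finset.sum_sub_distrib]
  refine (Finset.abs_sum_le_sum_abs _ _).trans ?_
  have hq : (q : ℝ) * w (Sum.inr i) = ∑ t : Fin q → R ⊕ Fin n, ∑ j : Fin q,
      (∏ i, (w (t i) : ℝ)) * (if t j = Sum.inr i then 1 else 0) := by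
    rw [Finset.sum_comm]
    simp_rw [sum_prod_mul_apply hw' (fun ω => if ω = Sum.inr i then (1 : ℝ) else 0)]
    simp
  rw [hq]
  refine Finset.sum_le_sum fun t _ => ?_
  rw [← mul_sub, abs_mul, ← Finset.mul_sum,
    abs_of_nonneg (Finset.prod_nonneg fun _ _ => NNReal.coe_nonneg _)]
  refine mul_le_mul_of_nonneg_left ?_ (Finset.prod_nonneg fun _ _ => NNReal.coe_nonneg _)
  by_cases ht : ∃ j, t j = Sum.inr i
  · obtain ⟨j, hj⟩ := ht
    have h1 : (1 : ℝ) ≤ ∑ j : Fin q, if t j = Sum.inr i then 1 else 0 := by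
      have := Finset.single_le_sum (f := fun j : Fin q => if t j = Sum.inr i then (1 : ℝ) else 0)
        (fun j _ => by split_ifs <;> norm_num) (Finset.mem_univ j)
      simpa [hj] using this
    refine le_trans ?_ h1
    rw [Set.indicator_apply, Set.indicator_apply]
    split_ifs <;> simp
  · push Not at ht
    have : placement y l X ∘ t = placement y l (Function.update X i b) ∘ t := by
      funext j
      have := ht j
      rcases h' : t j with r | v
      · simp [placement, h']
      · have hv : v ≠ i := by rintro rfl; exact this h'
        simp [placement, h', hv]
    rw [this, sub_self, abs_zero]
    exact Finset.sum_nonneg fun j _ => by split_ifs <;> norm_num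

/-- A fixed hypergraph rarely separates the distributions given by a random placement `X` and
by its permuted companion `τ ∘ X`. -/
theorem card_lt_abs_freq_placement_le [Fintype F] {n q : ℕ} (w : R ⊕ Fin n → ℝ≥0)
    (hw : ∑ ω, w ω = 1) (hn : ∀ i, (w (Sum.inr i) : ℝ) * n ≤ 1) (y : R → V) (l : Fin n → F → V)
    (τ : Equiv.Perm F) (h : Distinguisher q V) {t : ℝ} (ht : 0 ≤ t) :
    t ^ 2 * n * (Nat.card {X : Fin n → F | t < |freq (probMixture w hw (placement y l X)) h -
      freq (probMixture w hw (placement y l (τ ∘ X))) h|} : ℝ) ≤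
      4 * q ^ 2 * (Fintype.card F : ℝ) ^ n := by
  classical
  set f : (Fin n → F) → ℝ := fun X => freq (probMixture w hw (placement y l X)) h with hf
  set D : (Fin n → F) → ℝ := fun X => f X - f (τ ∘ X) with hD
  set K : ℝ := (Fintype.card F : ℝ) ^ n with hK
  rcases isEmpty_or_nonempty (Fin n → F) with hE | hE
  · simp only [Nat.card_eq_fintype_card, Fintype.card_eq_zero, Nat.cast_zero, mul_zero]
    positivity
  have hKpos : 0 < K := by
    have : (Fintype.card (Fin n → F) : ℝ) = K := by simp [hK]
    rw [← this]; exact_mod_cast Fintype.card_pos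
  -- Composition with `τ` permutes the placements, so both frequencies have the same mean.
  have hD0 : ∑ X, D X = 0 := by
    rw [hD]
    simp only [Finset.sum_sub_distrib, sub_eq_zero]
    exact (Equiv.sum_comp (Equiv.arrowCongr (Equiv.refl (Fin n)) τ) f).symm
  -- The factor 2 appears because an update of `X` at `i` also updates `τ ∘ X` at `i`.
  have hes := efronStein_of_bounded_differences n (fun i => 2 * (q * (w (Sum.inr i) : ℝ))) D (by
    intro X i b
    have h1 := abs_freq_placement_update_le w hw y l h X i b
    have h2 := abs_freq_placement_update_le w hw y l h (τ ∘ X) i (τ b)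
    rw [← Function.comp_update] at h2
    have : D X - D (Function.update X i b) = (f X - f (Function.update X i b)) -
        (f (τ ∘ X) - f (τ ∘ Function.update X i b)) := by simp only [hD]; ring
    rw [this]
    refine (abs_sub _ _).trans ?_
    simp only [hf]
    linarith)
  rw [hD0] at hes
  have hD2 : ∑ X, D X ^ 2 ≤ K * ∑ i : Fin n, (2 * (q * (w (Sum.inr i) : ℝ))) ^ 2 := by
    have : K * ∑ X, D X ^ 2 ≤ K * (K * ∑ i : Fin n, (2 * (q * (w (Sum.inr i) : ℝ))) ^ 2) := by
      rw [← mul_assoc, ← sq]; linarith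
    exact le_of_mul_le_mul_left this hKpos
  have hc : (n : ℝ) * ∑ i : Fin n, (2 * (q * (w (Sum.inr i) : ℝ))) ^ 2 ≤ 4 * q ^ 2 := by
    have h1 : ∑ i : Fin n, (w (Sum.inr i) : ℝ) ≤ 1 := by
      have hw' : ∑ ω, (w ω : ℝ) = 1 := by exact_mod_cast hw
      rw [Fintype.sum_sum_type] at hw'
      have : 0 ≤ ∑ r, (w (Sum.inl r) : ℝ) := Finset.sum_nonneg fun _ _ => NNReal.coe_nonneg _
      linarith
    calc (n : ℝ) * ∑ i : Fin n, (2 * (q * (w (Sum.inr i) : ℝ))) ^ 2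
        = 4 * q ^ 2 * ∑ i : Fin n, (w (Sum.inr i) * n) * (w (Sum.inr i) : ℝ) := by
          rw [Finset.mul_sum, Finset.mul_sum]
          exact Finset.sum_congr rfl fun i _ => by ring
      _ ≤ 4 * q ^ 2 * ∑ i : Fin n, (w (Sum.inr i) : ℝ) := by
          gcongr with i
          exact mul_le_of_le_one_left (NNReal.coe_nonneg _) (hn i)
      _ ≤ 4 * q ^ 2 * 1 := by gcongr
      _ = _ := mul_one _
  -- Chebyshev's inequality.
  have hcard : t ^ 2 * (Nat.card {X | t < |D X|} : ℝ) ≤ ∑ X, D X ^ 2 := by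
    rw [Nat.card_eq_fintype_card, Fintype.card_ofFinset, mul_comm, ← nsmul_eq_mul,
      ← Finset.sum_const]
    refine (Finset.sum_le_sum fun X hX => ?_).trans
      (Finset.sum_le_sum_of_subset_of_nonneg (Finset.filter_subset _ _)
        fun X _ _ => sq_nonneg (D X))
    have : t < |D X| := by simpa using hX
    rw [← sq_abs (D X)]
    gcongr
  calc t ^ 2 * n * (Nat.card {X | t < |D X|} : ℝ)
      = n * (t ^ 2 * (Nat.card {X | t < |D X|} : ℝ)) := by ring
    _ ≤ n * (K * ∑ i : Fin n, (2 * (q * (w (Sum.inr i) : ℝ))) ^ 2) :=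
          mul_le_mul_of_nonneg_left (hcard.trans hD2) (Nat.cast_nonneg n)
    _ = K * (n * ∑ i : Fin n, (2 * (q * (w (Sum.inr i) : ℝ))) ^ 2) := by ring
    _ ≤ K * (4 * q ^ 2) := by gcongr
    _ = _ := by ring

end Concentration

theorem natCard_setOf_eq_sum {α : Type*} [Fintype α] (p : α → Prop) [DecidablePred p] :
    (Nat.card {x | p x} : ℝ) = ∑ x, if p x then 1 else 0 := by
  rw [Finset.sum_boole, Nat.card_eq_fintype_card, Fintype.card_ofFinset]
  rfl

/-- A discriminable class rarely separates the distributions given by a random placement `X` and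
by its permuted companion `τ ∘ X`, once the number of random atoms is large. -/
theorem Discriminable.card_le_IPM_placement_lt {q : ℕ} {V : Type*} [MeasurableSpace V]
    [MeasurableSingletonClass V] {H : Set (Distinguisher q V)} (hH : Discriminable H) {F : Type*}
    [Fintype F] [Nonempty F] (τ : Equiv.Perm F) {ε c : ℝ} (hε : 0 < ε) (hc : 0 < c) :
    ∃ n₀ : ℕ, ∀ n : ℕ, n₀ ≤ n → ∀ (R : Type) [Fintype R] (w : R ⊕ Fin n → ℝ≥0)
      (hw : ∑ ω, w ω = 1), (∀ i, (w (Sum.inr i) : ℝ) * n ≤ 1) →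
      ∀ (y : R → V) (l : Fin n → F → V),
        (Nat.card {X : Fin n → F | ε ≤ IPM H (probMixture w hw (placement y l X))
          (probMixture w hw (placement y l (τ ∘ X)))} : ℝ) < c * (Fintype.card F : ℝ) ^ n := by
  classical
  obtain ⟨m, A, hA⟩ := hH
  -- The sample size must strictly exceed `m`. With IPM at least ε and accuracy ε/2, the output
  -- separates by more than ε/2.
  set M := m (ε / 2) (1 / 2) + 1 with hM
  -- This is the threshold at which the final bound |B| ε² n ≤ 32 |F|^(2M) q² K gives |B| < cK.
  set T : ℝ := 32 * (Fintype.card F : ℝ) ^ (2 * M) * q ^ 2 / (ε ^ 2 * c) with hT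
  obtain ⟨n₀, hn₀⟩ := exists_nat_gt T
  refine ⟨n₀, fun n hn R _ w hw hwn y l => ?_⟩
  have hTn : T < n := hn₀.trans_le (by exact_mod_cast hn)
  set K : ℝ := (Fintype.card F : ℝ) ^ n with hK
  have hKpos : 0 < K := by
    have : 0 < Fintype.card F := Fintype.card_pos
    positivity
  have hw' : ∑ ω, (w ω : ℝ) = 1 := by exact_mod_cast hw
  set P : (Fin n → F) → ProbabilityMeasure V := fun X => probMixture w hw (placement y l X) with hP
  set D : (Fin n → F) → Distinguisher q V → ℝ := fun X h => freq (P X) h - freq (P (τ ∘ X)) h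
    with hD
  set B : Finset (Fin n → F) := Finset.univ.filter fun X => ε ≤ IPM H (P X) (P (τ ∘ X)) with hB
  have hBcard : (Nat.card {X : Fin n → F | ε ≤ IPM H (P X) (P (τ ∘ X))} : ℝ) = B.card := by
    rw [Nat.card_eq_fintype_card, Fintype.card_ofFinset]
    congr 2
  change (Nat.card {X : Fin n → F | ε ≤ IPM H (P X) (P (τ ∘ X))} : ℝ) < c * K
  rw [hBcard]
  set W : (Fin M → R ⊕ Fin n) → ℝ := fun s => ∏ i, (w (s i) : ℝ) with hW
  have hW0 : ∀ s, 0 ≤ W s := fun s => Finset.prod_nonneg fun _ _ => NNReal.coe_nonneg _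
  have hW1 : ∑ s, W s = 1 := by
    have := sum_prod_mul_prod (q := M) (fun ω => (w ω : ℝ)) (fun _ _ => 1)
    simpa [hw'] using this
  have hprob : ∀ X ∈ B, (1 / 2 : ℝ) ≤ ∑ s : Fin M → R ⊕ Fin n, ∑ s' : Fin M → R ⊕ Fin n,
      W s * W s' * (if ε / 2 < |D X (A M M (placement y l X ∘ s)
        (placement y l (τ ∘ X) ∘ s')).1| then 1 else 0) := by
    intro X hX
    have h1 := hA (ε / 2) (1 / 2) (by positivity) (by norm_num) (by norm_num) M M
      (by omega) (by omega) (P X) (P (τ ∘ X))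
    have hIPM : ε ≤ IPM H (P X) (P (τ ∘ X)) := by simpa [hB] using hX
    have h2 : ((Measure.pi (fun _ : Fin M => (P X : Measure V))).prod
        (Measure.pi (fun _ : Fin M => (P (τ ∘ X) : Measure V)))) =
        mixture (fun t : (Fin M → R ⊕ Fin n) × (Fin M → R ⊕ Fin n) =>
          (∏ i, w (t.1 i)) * ∏ i, w (t.2 i))
          (fun t => (placement y l X ∘ t.1, placement y l (τ ∘ X) ∘ t.2)) := by
      change ((Measure.pi (fun _ : Fin M => mixture w (placement y l X))).prod
        (Measure.pi (fun _ : Fin M => mixture w (placement y l (τ ∘ X))))) = _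
      rw [pi_mixture, pi_mixture, prod_mixture]
    rw [h2, mixture_real, Fintype.sum_prod_type] at h1
    rw [show (1 : ℝ) - 1 / 2 = 1 / 2 by norm_num] at h1
    refine h1.trans
      (Finset.sum_le_sum fun s _ => Finset.sum_le_sum fun s' _ => ?_)
    simp only [NNReal.coe_mul, NNReal.coe_prod]
    refine mul_le_mul_of_nonneg_left ?_ (mul_nonneg (hW0 s) (hW0 s'))
    rw [Set.indicator_apply]
    split_ifs with h3 h4 h4
    · exact le_rfl
    · refine absurd ?_ h4
      simp only [Set.mem_ofPred_eq] at h3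
      simp only [hD]
      linarith
    · exact zero_le_one
    · exact le_rfl
  have hfix : ∀ h : Distinguisher q V, (ε / 2) ^ 2 * n *
      ∑ X : Fin n → F, (if ε / 2 < |D X h| then (1 : ℝ) else 0) ≤ 4 * q ^ 2 * K := by
    intro h
    have h1 := card_lt_abs_freq_placement_le w hw hwn y l τ h (half_pos hε).le
    rw [natCard_setOf_eq_sum] at h1
    exact h1
  -- Once the sampled atoms `s` are known, the sample depends on `X` through `M` values only. Hence
  -- the output lies among |F|^(2M) hypergraphs chosen independently of `X`, to each of which `hfix`
  -- applies.
  let ψ : (Fin M → R ⊕ Fin n) → (Fin M → F) → Fin M → V :=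
    fun s Y i => Sum.elim y (fun v => l v (Y i)) (s i)
  have hψ : ∀ (X : Fin n → F) (s : Fin M → R ⊕ Fin n), ∃ Y, placement y l X ∘ s = ψ s Y := by
    intro X s
    -- At a fixed atom the value of `Y` plays no role.
    refine ⟨fun i => Sum.elim (fun _ => Classical.arbitrary F) X (s i), ?_⟩
    funext i
    rcases h : s i with r | v <;> simp [ψ, placement, h]
  have hs : ∀ s s' : Fin M → R ⊕ Fin n, (ε / 2) ^ 2 * n *
      ∑ X : Fin n → F, (if ε / 2 < |D X (A M M (placement y l X ∘ s)
        (placement y l (τ ∘ X) ∘ s')).1| then (1 : ℝ) else 0) ≤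
      (Fintype.card F : ℝ) ^ (2 * M) * (4 * q ^ 2 * K) := by
    intro s s'
    have h1 : ∀ X : Fin n → F, (if ε / 2 < |D X (A M M (placement y l X ∘ s)
        (placement y l (τ ∘ X) ∘ s')).1| then (1 : ℝ) else 0) ≤
        ∑ Y : (Fin M → F) × (Fin M → F),
          if ε / 2 < |D X (A M M (ψ s Y.1) (ψ s' Y.2)).1| then (1 : ℝ) else 0 := by
      intro X
      obtain ⟨Y, hY⟩ := hψ X s
      obtain ⟨Y', hY'⟩ := hψ (τ ∘ X) s'
      rw [hY, hY']
      exact Finset.single_le_sum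
        (f := fun Y : (Fin M → F) × (Fin M → F) =>
          if ε / 2 < |D X (A M M (ψ s Y.1) (ψ s' Y.2)).1| then (1 : ℝ) else 0)
        (fun _ _ => by split_ifs <;> norm_num) (Finset.mem_univ (Y, Y'))
    calc _ ≤ (ε / 2) ^ 2 * n * ∑ X : Fin n → F, ∑ Y : (Fin M → F) × (Fin M → F),
          (if ε / 2 < |D X (A M M (ψ s Y.1) (ψ s' Y.2)).1| then (1 : ℝ) else 0) :=
          mul_le_mul_of_nonneg_left (Finset.sum_le_sum fun X _ => h1 X) (by positivity)
      _ = ∑ Y : (Fin M → F) × (Fin M → F), (ε / 2) ^ 2 * n * ∑ X : Fin n → F,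
          (if ε / 2 < |D X (A M M (ψ s Y.1) (ψ s' Y.2)).1| then (1 : ℝ) else 0) := by
          rw [Finset.sum_comm, Finset.mul_sum]
      _ ≤ ∑ _Y : (Fin M → F) × (Fin M → F), 4 * q ^ 2 * K :=
          Finset.sum_le_sum fun Y _ => hfix _
      _ = _ := by
          rw [Finset.sum_const, Finset.card_univ, nsmul_eq_mul]
          simp [two_mul, pow_add]
  have hmain : (ε / 2) ^ 2 * n * ((B.card : ℝ) * (1 / 2)) ≤
      (Fintype.card F : ℝ) ^ (2 * M) * (4 * q ^ 2 * K) := by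
    have h1 : (B.card : ℝ) * (1 / 2) ≤ ∑ X : Fin n → F, ∑ s : Fin M → R ⊕ Fin n,
        ∑ s' : Fin M → R ⊕ Fin n, W s * W s' * (if ε / 2 < |D X (A M M (placement y l X ∘ s)
        (placement y l (τ ∘ X) ∘ s')).1| then 1 else 0) := by
      rw [← nsmul_eq_mul, ← Finset.sum_const]
      refine (Finset.sum_le_sum hprob).trans
        (Finset.sum_le_sum_of_subset_of_nonneg (Finset.subset_univ _) fun X _ _ => ?_)
      refine Finset.sum_nonneg fun s _ => Finset.sum_nonneg fun s' _ =>
        mul_nonneg (mul_nonneg (hW0 s) (hW0 s')) ?_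
      split_ifs <;> norm_num
    calc _ ≤ (ε / 2) ^ 2 * n * _ := mul_le_mul_of_nonneg_left h1 (by positivity)
      _ = ∑ s, ∑ s', W s * W s' * ((ε / 2) ^ 2 * n * ∑ X : Fin n → F,
          (if ε / 2 < |D X (A M M (placement y l X ∘ s)
        (placement y l (τ ∘ X) ∘ s')).1| then (1 : ℝ) else 0)) := by
          rw [Finset.sum_comm, Finset.mul_sum]
          refine Finset.sum_congr rfl fun s _ => ?_
          rw [Finset.sum_comm, Finset.mul_sum]
          refine Finset.sum_congr rfl fun s' _ => ?_
          rw [← Finset.mul_sum]; ring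
      _ ≤ ∑ s, ∑ s', W s * W s' * ((Fintype.card F : ℝ) ^ (2 * M) * (4 * q ^ 2 * K)) :=
          Finset.sum_le_sum fun s _ => Finset.sum_le_sum fun s' _ =>
            mul_le_mul_of_nonneg_left (hs s s') (mul_nonneg (hW0 s) (hW0 s'))
      _ = _ := by
          simp_rw [← Finset.sum_mul, ← Finset.mul_sum, hW1, mul_one, hW1, one_mul]
  have h5 : 32 * (Fintype.card F : ℝ) ^ (2 * M) * q ^ 2 < n * (ε ^ 2 * c) := by
    rwa [hT, div_lt_iff₀ (by positivity)] at hTn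
  have hnpos : (0 : ℝ) < n := lt_of_le_of_lt (by positivity) hTn
  have h6 : (ε ^ 2 * n) * (B.card : ℝ) < (ε ^ 2 * n) * (c * K) := by
    have h7 := mul_lt_mul_of_pos_right h5 hKpos
    nlinarith [hmain, h7]
  exact lt_of_mul_lt_mul_left h6 (by positivity)

/-! ### Reduction to few fixed atoms. -/

/-- If the terms whose support has at least `q` elements vanish, then the total sum is controlled
by the partial sums over the terms supported in a fixed set with fewer than `q` elements. -/
theorem abs_sum_le_of_small_supports {T R : Type*} [Fintype T] [Fintype R] [DecidableEq R]
    (J : T → Finset R) {q : ℕ} (d : T → ℝ) (hd : ∀ t, q ≤ (J t).card → d t = 0) {η : ℝ}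
    (hη : 0 ≤ η) (h : ∀ S : Finset R, S.card < q → |∑ t with J t ⊆ S, d t| ≤ η) :
    |∑ t, d t| ≤ 2 ^ Fintype.card R * (2 * 2 ^ Fintype.card R) ^ Fintype.card R * η := by
  set N := Fintype.card R with hN
  set E : Finset R → ℝ := fun I => ∑ t with J t = I, d t with hE
  have hsum : ∀ S : Finset R, ∑ t with J t ⊆ S, d t = ∑ I ∈ S.powerset, E I := by
    intro S
    rw [← Finset.sum_fiberwise_of_maps_to (s := Finset.univ.filter fun t => J t ⊆ S)
      (t := S.powerset) (g := J) (by simp)]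
    refine Finset.sum_congr rfl fun I hI => ?_
    rw [Finset.filter_filter]
    refine Finset.sum_congr ?_ fun _ _ => rfl
    ext t
    simp only [Finset.mem_filter, Finset.mem_univ, true_and, and_iff_right_iff_imp]
    rintro rfl
    exact Finset.mem_powerset.1 hI
  have hcardN : ∀ I : Finset R, I.card ≤ N := fun I => Finset.card_le_univ I
  -- Möbius inversion by induction: `E I` is the partial sum over `I` minus the at most 2^N terms of
  -- proper subsets, so each further element costs a factor of at most 2 · 2^N.
  have hEI : ∀ n : ℕ, ∀ I : Finset R, I.card = n → |E I| ≤ (2 * 2 ^ N) ^ n * η := by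
    intro n
    induction n using Nat.strong_induction_on with
    | _ n ih =>
      intro I hI
      by_cases hq : q ≤ n
      · have : E I = 0 := by
          refine Finset.sum_eq_zero fun t ht => hd t ?_
          rw [(Finset.mem_filter.1 ht).2, hI]; exact hq
        rw [this, abs_zero]; positivity
      have h1 := h I (by omega)
      rw [hsum, ← Finset.insert_erase (Finset.mem_powerset_self I),
        Finset.sum_insert (Finset.notMem_erase _ _)] at h1
      have h2 : |∑ I' ∈ I.powerset.erase I, E I'| ≤ 2 ^ N * ((2 * 2 ^ N) ^ (n - 1) * η) := by
        refine (Finset.abs_sum_le_sum_abs _ _).trans ?_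
        refine (Finset.sum_le_card_nsmul _ _ ((2 * 2 ^ N) ^ (n - 1) * η) fun I' hI' => ?_).trans ?_
        · rw [Finset.mem_erase, Finset.mem_powerset] at hI'
          have hlt : I'.card < n := by
            rw [← hI]
            exact Finset.card_lt_card (hI'.2.ssubset_of_ne hI'.1)
          refine (ih _ hlt I' rfl).trans ?_
          have : (1 : ℝ) ≤ 2 * 2 ^ N := by
            have : (1 : ℝ) ≤ 2 ^ N := one_le_pow₀ (by norm_num)
            linarith
          exact mul_le_mul_of_nonneg_right (pow_le_pow_right₀ this (by omega)) hη
        · rw [nsmul_eq_mul]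
          refine mul_le_mul_of_nonneg_right ?_ (by positivity)
          have : (I.powerset.erase I).card ≤ 2 ^ N := by
            refine (Finset.card_erase_le).trans ?_
            rw [Finset.card_powerset]
            exact Nat.pow_le_pow_right (by norm_num) (hcardN I)
          exact_mod_cast this
      rcases Nat.eq_zero_or_pos n with h0 | hpos
      · subst h0
        have : I = ∅ := Finset.card_eq_zero.1 hI
        subst this
        simpa using h1
      · have h3 : |E I| ≤ η + |∑ I' ∈ I.powerset.erase I, E I'| := by
          have := abs_sub_abs_le_abs_sub (E I) (-∑ I' ∈ I.powerset.erase I, E I')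
          rw [abs_neg, sub_neg_eq_add] at this
          linarith
        have h4 : (2 * 2 ^ N : ℝ) ^ n = 2 * 2 ^ N * (2 * 2 ^ N) ^ (n - 1) :=
          (mul_pow_sub_one hpos.ne' _).symm
        have h5 : (1 : ℝ) ≤ 2 ^ N * (2 * 2 ^ N) ^ (n - 1) := by
          have h6 : (1 : ℝ) ≤ 2 ^ N := one_le_pow₀ (by norm_num)
          exact one_le_mul_of_one_le_of_one_le h6 (one_le_pow₀ (by linarith))
        rw [h4]
        nlinarith
  have huniv : ∑ t, d t = ∑ I : Finset R, E I := by
    have := hsum Finset.univ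
    simpa using this
  rw [huniv]
  refine (Finset.abs_sum_le_sum_abs _ _).trans ?_
  refine (Finset.sum_le_card_nsmul _ _ ((2 * 2 ^ N) ^ N * η) fun I _ => ?_).trans ?_
  · refine (hEI _ I rfl).trans ?_
    have : (1 : ℝ) ≤ 2 * 2 ^ N := by
      have : (1 : ℝ) ≤ 2 ^ N := one_le_pow₀ (by norm_num)
      linarith
    exact mul_le_mul_of_nonneg_right (pow_le_pow_right₀ this (hcardN I)) hη
  · rw [Finset.card_univ, Fintype.card_finset, nsmul_eq_mul]
    push_cast
    rw [mul_assoc]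

section Restrict

variable {R : Type*} [DecidableEq R] {n : ℕ}

/-- The weights in which the fixed atoms outside `S` are discarded. -/
def maskWeights (w : R ⊕ Fin n → ℝ≥0) (S : Finset R) : R ⊕ Fin n → ℝ≥0 :=
  Sum.elim (fun u => if u ∈ S then w (Sum.inl u) else 0) fun i => w (Sum.inr i)

theorem maskWeights_le (w : R ⊕ Fin n → ℝ≥0) (S : Finset R) (ω : R ⊕ Fin n) :
    maskWeights w S ω ≤ w ω := by
  rcases ω with u | i
  · simp only [maskWeights, Sum.elim_inl]
    split_ifs
    · exact le_rfl
    · exact zero_le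
  · exact le_rfl

variable [Fintype R]

/-- The weights, conditioned on the fixed atom being in `S` or on the atom being random. -/
def restrictWeights (w : R ⊕ Fin n → ℝ≥0) (S : Finset R) (ω : R ⊕ Fin n) : ℝ≥0 :=
  maskWeights w S ω / ∑ ω', maskWeights w S ω'

theorem sum_maskWeights_pos {w : R ⊕ Fin n → ℝ≥0} (hpos : 0 < ∑ i, w (Sum.inr i))
    (S : Finset R) : 0 < ∑ ω, maskWeights w S ω := by
  rw [Fintype.sum_sum_type]
  exact add_pos_of_nonneg_of_pos (zero_le) hpos

theorem sum_restrictWeights {w : R ⊕ Fin n → ℝ≥0} (hpos : 0 < ∑ i, w (Sum.inr i))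
    (S : Finset R) : ∑ ω, restrictWeights w S ω = 1 := by
  simp only [restrictWeights, ← Finset.sum_div]
  exact div_self (sum_maskWeights_pos hpos S).ne'

/-- A `q`-tuple with `q` distinct fixed atoms has no random atom, so it contributes equally to both
frequencies. The tuples whose fixed atoms lie in a smaller set `S` contribute the frequency
difference for the conditioned weights, up to a normalising factor of at most 1. -/
theorem IPM_placement_le_of_restrictWeights {q : ℕ} (hq : 0 < q) {V F : Type*}
    [MeasurableSpace V] [MeasurableSingletonClass V] (H : Set (Distinguisher q V))
    {w : R ⊕ Fin n → ℝ≥0} (hw : ∑ ω, w ω = 1) (hpos : 0 < ∑ i, w (Sum.inr i))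
    (y : R → V) (l : Fin n → F → V) (X X' : Fin n → F) {η : ℝ}
    (h : ∀ S : Finset R, S.card < q →
      IPM H (probMixture (restrictWeights w S) (sum_restrictWeights hpos S) (placement y l X))
        (probMixture (restrictWeights w S) (sum_restrictWeights hpos S) (placement y l X')) ≤ η) :
    IPM H (probMixture w hw (placement y l X)) (probMixture w hw (placement y l X')) ≤
      2 ^ Fintype.card R * (2 * 2 ^ Fintype.card R) ^ Fintype.card R * η := by
  have hη : 0 ≤ η := (Real.iSup_nonneg fun _ => abs_nonneg _).trans (h ∅ (by simpa using hq))
  refine Real.iSup_le (fun ⟨g, hg⟩ => ?_) (by positivity)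
  set J : (Fin q → R ⊕ Fin n) → Finset R := fun t => Finset.univ.filter fun u => ∃ i, t i = Sum.inl u
    with hJ
  set e : (Fin q → R ⊕ Fin n) → ℝ := fun t =>
    g.edges.indicator 1 (placement y l X ∘ t) - g.edges.indicator 1 (placement y l X' ∘ t) with he
  set d : (Fin q → R ⊕ Fin n) → ℝ := fun t => (∏ i, (w (t i) : ℝ)) * e t with hd
  have hfreq : freq (probMixture w hw (placement y l X)) g -
      freq (probMixture w hw (placement y l X')) g = ∑ t, d t := by
    rw [freq_probMixture, freq_probMixture, ← Finset.sum_sub_distrib]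
    exact Finset.sum_congr rfl fun t _ => (mul_sub _ _ _).symm
  rw [hfreq]
  refine abs_sum_le_of_small_supports J (q := q) d (fun t ht => ?_) hη fun S hS => ?_
  · have hall : ∀ i, ∃ u, t i = Sum.inl u := by
      by_contra hcon
      push Not at hcon
      obtain ⟨i₀, hi₀⟩ := hcon
      -- Pigeonhole: a coordinate holding a random atom leaves at most `q - 1` for fixed ones.
      have hsub : (J t).image Sum.inl ⊆ (Finset.univ.erase i₀).image t := by
        intro ω hω
        obtain ⟨u, hu, rfl⟩ := Finset.mem_image.1 hω
        obtain ⟨i, hi⟩ := (Finset.mem_filter.1 hu).2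
        refine Finset.mem_image.2 ⟨i, Finset.mem_erase.2 ⟨?_, Finset.mem_univ _⟩, hi⟩
        rintro rfl
        exact hi₀ u hi
      have h1 := Finset.card_le_card hsub
      rw [Finset.card_image_of_injective _ Sum.inl_injective] at h1
      have h2 := h1.trans Finset.card_image_le
      rw [Finset.card_erase_of_mem (Finset.mem_univ _), Finset.card_univ, Fintype.card_fin] at h2
      omega
    have : placement y l X ∘ t = placement y l X' ∘ t := by
      funext i
      obtain ⟨u, hu⟩ := hall i
      simp [placement, hu]
    simp [hd, he, this]
  · set W : ℝ := ((∑ ω, maskWeights w S ω : ℝ≥0) : ℝ) with hW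
    have hW0 : 0 < W := by exact_mod_cast sum_maskWeights_pos hpos S
    have hW1 : W ≤ 1 := by
      have : ∑ ω, maskWeights w S ω ≤ 1 := by
        rw [← hw]; exact Finset.sum_le_sum fun ω _ => maskWeights_le w S ω
      exact_mod_cast this
    have h1 := (le_IPM _ _ hg).trans (h S hS)
    rw [freq_probMixture, freq_probMixture, ← Finset.sum_sub_distrib] at h1
    have h2 : ∑ t : Fin q → R ⊕ Fin n, ((∏ i, (restrictWeights w S (t i) : ℝ)) *
          g.edges.indicator 1 (placement y l X ∘ t) -
        (∏ i, (restrictWeights w S (t i) : ℝ)) * g.edges.indicator 1 (placement y l X' ∘ t)) =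
        (W ^ q)⁻¹ * ∑ t with J t ⊆ S, d t := by
      rw [Finset.mul_sum, Finset.sum_filter]
      refine Finset.sum_congr rfl fun t _ => ?_
      rw [← mul_sub]
      have h3 : ∏ i, (restrictWeights w S (t i) : ℝ) =
          (W ^ q)⁻¹ * ∏ i, (maskWeights w S (t i) : ℝ) := by
        simp only [restrictWeights, NNReal.coe_div, Finset.prod_div_distrib, ← hW]
        simp [div_eq_inv_mul]
      rw [h3]
      split_ifs with hJS
      · have h5 : ∏ i, (maskWeights w S (t i) : ℝ) = ∏ i, (w (t i) : ℝ) := by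
          refine Finset.prod_congr rfl fun i _ => ?_
          rcases hi : t i with u | v
          · have : u ∈ S := hJS (Finset.mem_filter.2 ⟨Finset.mem_univ _, i, hi⟩)
            simp [maskWeights, this]
          · rfl
        rw [h5, mul_assoc]
      · obtain ⟨u, hu, huS⟩ := Finset.not_subset.1 hJS
        obtain ⟨i, hi⟩ := (Finset.mem_filter.1 hu).2
        rw [Finset.prod_eq_zero (Finset.mem_univ i) (by simp [hi, maskWeights, huS])]
        ring
    rw [h2, abs_mul, abs_of_pos (by positivity)] at h1
    have h4 : 1 ≤ (W ^ q)⁻¹ := (one_le_inv₀ (by positivity)).2 (pow_le_one₀ hW0.le hW1)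
    exact (le_mul_of_one_le_left (abs_nonneg _) h4).trans h1

end Restrict

/-- Serves to show that after conditioning on `S` the shares outside `S` are irrelevant. -/
theorem probMixture_congr {Ω V : Type*} [Fintype Ω] [MeasurableSpace V] {w : Ω → ℝ≥0}
    (hw : ∑ ω, w ω = 1) {φ φ' : Ω → V} (h : ∀ ω, w ω ≠ 0 → φ ω = φ' ω) :
    probMixture w hw φ = probMixture w hw φ' := by
  refine Subtype.ext (Finset.sum_congr rfl fun ω _ => ?_)
  by_cases h0 : w ω = 0
  · simp [h0]
  · rw [h ω h0]

/-! ### The secret sharing hypergraph. -/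

/-- The vertices of the secret sharing hypergraph: a left vertex `(v, b)` claims that the `v`-th
secret is `b`; a right vertex `(α, y)` carries the shares `y` at the point `α` of a sequence of
secrets. -/
abbrev ShareVertex (F : Type*) : Type _ := (ℕ × F) ⊕ (F × List F)

/-- One of the vertices is a left vertex `(v, b)`, the others are right vertices, and some
polynomial of degree less than `q` has the value `b` at `0` and interpolates the `v`-th entries of
all the shares. -/
def IsShareEdge {F ι : Type*} [Field F] (q : ℕ) (t : ι → ShareVertex F) : Prop :=
  ∃ i₀ v b, t i₀ = Sum.inl (v, b) ∧ ∃ P : Polynomial F, P.degree < q ∧ P.eval 0 = b ∧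
    ∀ i, i ≠ i₀ → ∃ α y, t i = Sum.inr (α, y) ∧ P.eval α = y.getD v 0

theorem IsShareEdge.comp_equiv {F ι κ : Type*} [Field F] {q : ℕ} {t : ι → ShareVertex F}
    (h : IsShareEdge q t) (π : κ ≃ ι) : IsShareEdge q (t ∘ π) := by
  obtain ⟨i₀, v, b, h0, P, hP, hb, hi⟩ := h
  refine ⟨π.symm i₀, v, b, by simpa using h0, P, hP, hb, fun i hne => ?_⟩
  exact hi (π i) fun h => hne (by rw [← h, Equiv.symm_apply_apply])

/-- The `(q + 1)`-hypergraph on `V` whose hyperedges are the consistent share edges, transported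
along `e`. -/
def shareHypergraph {F V : Type*} [Field F] (q : ℕ) (e : ShareVertex F → V) :
    Distinguisher (q + 1) V where
  edges := {v | ∃ t : Fin (q + 1) → ShareVertex F, v = e ∘ t ∧ IsShareEdge q t}
  symm := by
    have key : ∀ (π : Equiv.Perm (Fin (q + 1))) (v : Fin (q + 1) → V),
        (∃ t : Fin (q + 1) → ShareVertex F, v = e ∘ t ∧ IsShareEdge q t) →
        ∃ t : Fin (q + 1) → ShareVertex F, v ∘ π = e ∘ t ∧ IsShareEdge q t := by
      rintro π v ⟨t, rfl, ht⟩
      exact ⟨t ∘ π, rfl, ht.comp_equiv π⟩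
    intro π v
    refine ⟨fun h => ?_, key π v⟩
    have := key π⁻¹ (v ∘ π) h
    rwa [show (v ∘ π) ∘ (π⁻¹ : Equiv.Perm (Fin (q + 1))) = v by
      funext i; simp [Function.comp]] at this

theorem comp_mem_edges_shareHypergraph {F V : Type*} [Field F] {q : ℕ} {e : ShareVertex F → V}
    (he : Function.Injective e) (t : Fin (q + 1) → ShareVertex F) :
    e ∘ t ∈ (shareHypergraph q e).edges ↔ IsShareEdge q t := by
  refine ⟨?_, fun h => ⟨t, rfl, h⟩⟩
  rintro ⟨t', h, ht'⟩
  rwa [he.comp_left h]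

section Gap

variable {F : Type*} [Field F] {n : ℕ}

/-- The right vertex that carries the values at `u` of the polynomials `P`. -/
def shareVertex (P : Fin n → Polynomial F) (u : Fˣ) : ShareVertex F :=
  Sum.inr ((u : F), List.ofFn fun v => (P v).eval (u : F))

/-- The left vertex that claims that the `v`-th secret is `b`. -/
def claimVertex (v : Fin n) (b : F) : ShareVertex F := Sum.inl ((v : ℕ), b)

/-- The atom at the position `i₀` is random, all the others are fixed ones. -/
def HasUniqueRandomAtom {R : Type*} {k : ℕ} (t : Fin k → R ⊕ Fin n) (i₀ : Fin k) : Prop :=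
  (∃ v, t i₀ = Sum.inr v) ∧ ∀ i, i ≠ i₀ → ∃ u, t i = Sum.inl u

theorem isShareEdge_of_hasUniqueRandomAtom {q : ℕ} {P : Fin n → Polynomial F}
    (hP : ∀ v, (P v).degree < q) {t : Fin (q + 1) → Fˣ ⊕ Fin n} {i₀ : Fin (q + 1)}
    (ht : HasUniqueRandomAtom t i₀) :
    IsShareEdge q
      (placement (shareVertex P) claimVertex (fun v => (P v).eval 0) ∘ t) := by
  obtain ⟨⟨v, hv⟩, hi⟩ := ht
  refine ⟨i₀, v, (P v).eval 0, by simp [placement, hv, claimVertex], P v, hP v, rfl,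
    fun i hne => ?_⟩
  obtain ⟨u, hu⟩ := hi i hne
  exact ⟨u, _, by simp only [Function.comp, hu, placement, Sum.elim_inl, shareVertex]; rfl,
    by simp [List.getD]⟩

/-- Random atoms are always placed on left vertices and fixed ones on right vertices, whatever the
claims `X` are. -/
theorem exists_hasUniqueRandomAtom_of_isShareEdge {q : ℕ} {P : Fin n → Polynomial F}
    {X : Fin n → F} {t : Fin (q + 1) → Fˣ ⊕ Fin n}
    (ht : IsShareEdge q (placement (shareVertex P) claimVertex X ∘ t)) :
    ∃ i₀, HasUniqueRandomAtom t i₀ := by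
  obtain ⟨i₀, v, b, h0, Q, -, -, hi⟩ := ht
  refine ⟨i₀, ?_, fun i hne => ?_⟩
  · rcases h : t i₀ with u | v
    · simp [placement, h, shareVertex] at h0
    · exact ⟨v, rfl⟩
  · obtain ⟨α, y, h1, -⟩ := hi i hne
    rcases h : t i with u | v
    · exact ⟨u, rfl⟩
    · simp [placement, h, claimVertex] at h1

/-- If the `q` shares were distinct, the interpolating polynomial would agree with `P v` at `q`
points, hence be equal to it, and the claim would be right. -/
theorem exists_ne_eq_inl_of_isShareEdge {q : ℕ} {P : Fin n → Polynomial F}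
    (hP : ∀ v, (P v).degree < q) {X : Fin n → F} (hX : ∀ v, X v ≠ (P v).eval 0)
    {t : Fin (q + 1) → Fˣ ⊕ Fin n}
    (ht : IsShareEdge q (placement (shareVertex P) claimVertex X ∘ t)) :
    ∃ i j, i ≠ j ∧ ∃ u, t i = Sum.inl u ∧ t j = Sum.inl u := by
  obtain ⟨i₁, h1⟩ := exists_hasUniqueRandomAtom_of_isShareEdge ht
  obtain ⟨i₀, v', b, h0, Q, hQ, hQb, hi⟩ := ht
  by_contra hcon
  push Not at hcon
  obtain ⟨v, hv⟩ : ∃ v, t i₀ = Sum.inr v := by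
    rcases h : t i₀ with u | v
    · simp [placement, h, shareVertex] at h0
    · exact ⟨v, rfl⟩
  simp only [Function.comp, hv, placement, Sum.elim_inr, claimVertex, Sum.inl.injEq,
    Prod.mk.injEq] at h0
  obtain ⟨rfl, rfl⟩ := h0
  have hu : ∀ i, i ≠ i₀ → ∃ u : Fˣ, t i = Sum.inl u ∧ Q.eval (u : F) = (P v).eval (u : F) := by
    intro i hne
    obtain ⟨α, y, h1, h2⟩ := hi i hne
    rcases h : t i with u | v
    · simp only [Function.comp, h, placement, Sum.elim_inl, shareVertex, Sum.inr.injEq,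
        Prod.mk.injEq] at h1
      obtain ⟨rfl, rfl⟩ := h1
      exact ⟨u, rfl, by simpa [List.getD] using h2⟩
    · simp [placement, h, claimVertex] at h1
  choose! u hu1 hu2 using hu
  have hcard : (Finset.univ.erase i₀).card = q := by simp
  have : Q = P v := by
    refine Polynomial.eq_of_degrees_lt_of_eval_index_eq (s := Finset.univ.erase i₀)
      (v := fun i => (u i : F)) ?_ (by rwa [hcard]) (by rw [hcard]; exact hP v) ?_
    · intro i hi j hj hij
      by_contra hne
      have hi' : i ≠ i₀ := (Finset.mem_erase.1 hi).1
      have hj' : j ≠ i₀ := (Finset.mem_erase.1 hj).1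
      have huij : u i = u j := Units.ext hij
      exact hcon i j hne (u i) (hu1 i hi') (by rw [hu1 j hj', huij])
    · intro i hi
      exact hu2 i (Finset.mem_erase.1 hi).1
  exact hX v (by rw [← hQb, this])

end Gap

/-! ### Edge frequencies with right and wrong claims. -/

/-- The weights that give the total mass `1 / (q + 1)` to the `n` random atoms. -/
def shareWeights (R : Type*) [Fintype R] (q n : ℕ) : R ⊕ Fin n → ℝ≥0 :=
  Sum.elim (fun _ => q / ((q + 1) * Fintype.card R)) fun _ => 1 / ((q + 1) * n)

theorem sum_shareWeights_inr (R : Type*) [Fintype R] (q : ℕ) {n : ℕ} (hn : 0 < n) :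
    ∑ i : Fin n, shareWeights R q n (Sum.inr i) = 1 / (q + 1) := by
  have : (n : ℝ≥0) ≠ 0 := by exact_mod_cast hn.ne'
  simp only [shareWeights, Sum.elim_inr, Finset.sum_const, Finset.card_univ, Fintype.card_fin,
    nsmul_eq_mul]
  field_simp

theorem sum_shareWeights_inl (R : Type*) [Fintype R] [Nonempty R] (q n : ℕ) :
    ∑ u : R, shareWeights R q n (Sum.inl u) = q / (q + 1) := by
  have : (Fintype.card R : ℝ≥0) ≠ 0 := by exact_mod_cast Fintype.card_ne_zero
  simp only [shareWeights, Sum.elim_inl, Finset.sum_const, Finset.card_univ, nsmul_eq_mul]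
  field_simp

theorem sum_shareWeights (R : Type*) [Fintype R] [Nonempty R] (q : ℕ) {n : ℕ} (hn : 0 < n) :
    ∑ ω, shareWeights R q n ω = 1 := by
  rw [Fintype.sum_sum_type, sum_shareWeights_inl, sum_shareWeights_inr R q hn, ← add_div]
  exact div_self (by positivity)

/-- The tuples of atoms with exactly one random atom. -/
def uniqueRandomAtoms {R : Type*} {n k : ℕ} : Set (Fin k → R ⊕ Fin n) :=
  {t | ∃ i₀, HasUniqueRandomAtom t i₀}

/-- The tuples of atoms in which some fixed atom is repeated. -/
def collisions {R : Type*} {n k : ℕ} : Set (Fin k → R ⊕ Fin n) :=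
  {t | ∃ i j, i ≠ j ∧ ∃ u, t i = Sum.inl u ∧ t j = Sum.inl u}

section UniqueAtom

variable {R : Type*} [Fintype R] {n q : ℕ}

/-- There are q + 1 positions for the random atom, each with probability (1/(q+1)) (q/(q+1))^q. The
mass 1/(q+1) of the random atoms maximises this total. -/
theorem sum_weight_hasUniqueRandomAtom_ge [Nonempty R] (hn : 0 < n) :
    ((q : ℝ) / (q + 1)) ^ q ≤ ∑ t : Fin (q + 1) → R ⊕ Fin n,
      (∏ i, (shareWeights R q n (t i) : ℝ)) *
        uniqueRandomAtoms.indicator 1 t := by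
  classical
  set w : R ⊕ Fin n → ℝ := fun ω => (shareWeights R q n ω : ℝ) with hw
  set g : Fin (q + 1) → Fin (q + 1) → R ⊕ Fin n → ℝ := fun i₀ i =>
    if i = i₀ then Sum.elim (fun _ => 0) (fun _ => 1) else Sum.elim (fun _ => 1) (fun _ => 0)
    with hg
  have hprod : ∀ i₀ (t : Fin (q + 1) → R ⊕ Fin n),
      ∏ i, g i₀ i (t i) = if HasUniqueRandomAtom t i₀ then 1 else 0 := by
    intro i₀ t
    split_ifs with h
    · refine Finset.prod_eq_one fun i _ => ?_
      by_cases hi : i = i₀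
      · subst hi
        obtain ⟨v, hv⟩ := h.1
        simp [hg, hv]
      · obtain ⟨u, hu⟩ := h.2 i hi
        simp [hg, hi, hu]
    · by_contra hne
      refine h ⟨?_, fun i hi => ?_⟩
      · have := Finset.prod_ne_zero_iff.1 hne i₀ (Finset.mem_univ _)
        rcases h' : t i₀ with u | v
        · simp [hg, h'] at this
        · exact ⟨v, rfl⟩
      · have := Finset.prod_ne_zero_iff.1 hne i (Finset.mem_univ _)
        rcases h' : t i with u | v
        · exact ⟨u, rfl⟩
        · simp [hg, h', hi] at this
  have hle : ∀ t : Fin (q + 1) → R ⊕ Fin n, ∑ i₀, ∏ i, g i₀ i (t i) ≤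
      uniqueRandomAtoms.indicator 1 t := by
    intro t
    simp_rw [hprod]
    rw [Set.indicator_apply, Pi.one_apply]
    split_ifs with h
    · obtain ⟨i₀, hi₀⟩ := h
      rw [Finset.sum_eq_single i₀]
      · rw [if_pos hi₀]
      · intro i _ hne
        rw [if_neg]
        intro hi
        obtain ⟨v, hv⟩ := hi.1
        obtain ⟨u, hu⟩ := hi₀.2 i hne
        rw [hu] at hv
        cases hv
      · simp
    · simp only [uniqueRandomAtoms, Set.mem_ofPred_eq, not_exists] at h
      simp [h]
  have hr : ∑ i : Fin n, w (Sum.inr i) = 1 / ((q : ℝ) + 1) := by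
    have := sum_shareWeights_inr R q hn
    simp only [hw]
    rw [← NNReal.coe_sum, this]
    push_cast
    rfl
  have hl : ∑ u : R, w (Sum.inl u) = q / ((q : ℝ) + 1) := by
    have := sum_shareWeights_inl R q n
    simp only [hw]
    rw [← NNReal.coe_sum, this]
    push_cast
    rfl
  have hmarg : ∀ i₀ i, ∑ ω, w ω * g i₀ i ω =
      if i = i₀ then 1 / ((q : ℝ) + 1) else q / ((q : ℝ) + 1) := by
    intro i₀ i
    rw [Fintype.sum_sum_type]
    by_cases hi : i = i₀ <;> simp [hg, hi, hr, hl]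
  calc ((q : ℝ) / (q + 1)) ^ q
      = ∑ i₀ : Fin (q + 1), ∏ i, ∑ ω, w ω * g i₀ i ω := by
        simp_rw [hmarg, Finset.prod_ite, Finset.prod_const]
        have h1 : ∀ i₀ : Fin (q + 1), (Finset.univ.filter fun i => i = i₀).card = 1 := by
          intro i₀; simp [Finset.filter_eq']
        have h2 : ∀ i₀ : Fin (q + 1), (Finset.univ.filter fun i => ¬ i = i₀).card = q := by
          intro i₀; simp [Finset.filter_ne']
        simp_rw [h1, h2]
        rw [Finset.sum_const, Finset.card_univ, Fintype.card_fin, nsmul_eq_mul]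
        push_cast
        field_simp
    _ = ∑ t : Fin (q + 1) → R ⊕ Fin n, (∏ i, w (t i)) * ∑ i₀, ∏ i, g i₀ i (t i) := by
        simp_rw [← sum_prod_mul_prod, Finset.mul_sum]
        rw [Finset.sum_comm]
    _ ≤ _ := Finset.sum_le_sum fun t _ => mul_le_mul_of_nonneg_left (hle t)
        (Finset.prod_nonneg fun _ _ => NNReal.coe_nonneg _)

/-- Union bound over positions `i`, `j` and the repeated atom `u`; including the diagonal `i = j`,
it is (q+1)² |R| c² with c the weight of one fixed atom. -/
theorem sum_weight_collision_le [Nonempty R] (hn : 0 < n) :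
    ∑ t : Fin (q + 1) → R ⊕ Fin n, (∏ i, (shareWeights R q n (t i) : ℝ)) *
      collisions.indicator 1 t ≤
      (q : ℝ) ^ 2 / Fintype.card R := by
  classical
  set w : R ⊕ Fin n → ℝ := fun ω => (shareWeights R q n ω : ℝ) with hw
  have hw1 : ∑ ω, w ω = 1 := by
    simp only [hw]
    exact_mod_cast sum_shareWeights R q hn
  set g : Fin (q + 1) → Fin (q + 1) → R → Fin (q + 1) → R ⊕ Fin n → ℝ := fun i j u m =>
    if m ∈ ({i, j} : Finset _) then (fun ω => if ω = Sum.inl u then 1 else 0) else fun _ => 1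
    with hg
  have hg0 : ∀ i j u m ω, 0 ≤ g i j u m ω := by
    intro i j u m ω
    simp only [hg]
    by_cases h : m ∈ ({i, j} : Finset _)
    · rw [if_pos h]; split_ifs <;> norm_num
    · rw [if_neg h]; norm_num
  have hle : ∀ t : Fin (q + 1) → R ⊕ Fin n,
      collisions.indicator 1 t ≤
        ∑ i, ∑ j ∈ Finset.univ.filter (fun j => i ≠ j), ∑ u, ∏ m, g i j u m (t m) := by
    intro t
    have h0 : ∀ i j u, 0 ≤ ∏ m, g i j u m (t m) := fun i j u =>
      Finset.prod_nonneg fun m _ => hg0 i j u m _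
    rw [Set.indicator_apply, Pi.one_apply]
    split_ifs with h
    · obtain ⟨i, j, hij, u, hi, hj⟩ := h
      have h1 : ∏ m, g i j u m (t m) = 1 := by
        refine Finset.prod_eq_one fun m _ => ?_
        by_cases hm : m ∈ ({i, j} : Finset _)
        · simp only [hg, if_pos hm]
          rcases Finset.mem_insert.1 hm with rfl | hm
          · simp [hi]
          · rw [Finset.mem_singleton.1 hm]; simp [hj]
        · simp only [hg, if_neg hm]
      rw [← h1]
      refine le_trans ?_ (Finset.single_le_sum (f := fun i =>
        ∑ j ∈ Finset.univ.filter (fun j => i ≠ j), ∑ u, ∏ m, g i j u m (t m))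
        (fun i _ => Finset.sum_nonneg fun j _ => Finset.sum_nonneg fun u _ => h0 i j u)
        (Finset.mem_univ i))
      refine le_trans ?_ (Finset.single_le_sum (f := fun j => ∑ u, ∏ m, g i j u m (t m))
        (fun j _ => Finset.sum_nonneg fun u _ => h0 i j u)
        (Finset.mem_filter.2 ⟨Finset.mem_univ j, hij⟩))
      exact Finset.single_le_sum (f := fun u => ∏ m, g i j u m (t m)) (fun u _ => h0 i j u)
        (Finset.mem_univ u)
    · exact Finset.sum_nonneg fun i _ => Finset.sum_nonneg fun j _ =>
        Finset.sum_nonneg fun u _ => h0 i j u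
  set c : ℝ := q / ((q + 1) * Fintype.card R) with hc
  have hmarg : ∀ i j, i ≠ j → ∀ u, ∏ m, ∑ ω, w ω * g i j u m ω = c ^ 2 := by
    intro i j hij u
    have h1 : ∀ m, ∑ ω, w ω * g i j u m ω = if m ∈ ({i, j} : Finset _) then c else 1 := by
      intro m
      by_cases hm : m ∈ ({i, j} : Finset _)
      · simp only [hg, if_pos hm]
        simp [hw, hc, shareWeights]
      · simp only [hg, if_neg hm, mul_one, hw1]
    simp_rw [h1]
    rw [Finset.prod_ite_mem, Finset.univ_inter, Finset.prod_const, Finset.card_pair hij]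
  have hN : (0 : ℝ) < Fintype.card R := by exact_mod_cast Fintype.card_pos
  calc _ ≤ ∑ t : Fin (q + 1) → R ⊕ Fin n, (∏ i, w (t i)) *
        ∑ i, ∑ j ∈ Finset.univ.filter (fun j => i ≠ j), ∑ u, ∏ m, g i j u m (t m) :=
        Finset.sum_le_sum fun t _ => mul_le_mul_of_nonneg_left (hle t)
          (Finset.prod_nonneg fun _ _ => NNReal.coe_nonneg _)
    _ = ∑ i, ∑ j ∈ Finset.univ.filter (fun j => i ≠ j), ∑ u,
        ∏ m, ∑ ω, w ω * g i j u m ω := by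
        simp_rw [← sum_prod_mul_prod, Finset.mul_sum]
        rw [Finset.sum_comm]
        refine Finset.sum_congr rfl fun i _ => ?_
        rw [Finset.sum_comm]
        refine Finset.sum_congr rfl fun j _ => ?_
        rw [Finset.sum_comm]
    _ = ∑ i : Fin (q + 1), ∑ j ∈ Finset.univ.filter (fun j => i ≠ j), ∑ _u : R, c ^ 2 :=
        Finset.sum_congr rfl fun i _ => Finset.sum_congr rfl fun j hj =>
          Finset.sum_congr rfl fun u _ => hmarg i j (Finset.mem_filter.1 hj).2 u
    _ ≤ ∑ _i : Fin (q + 1), ∑ _j : Fin (q + 1), ∑ _u : R, c ^ 2 :=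
        Finset.sum_le_sum fun i _ => Finset.sum_le_sum_of_subset_of_nonneg
          (Finset.subset_univ _) fun _ _ _ => Finset.sum_nonneg fun _ _ => sq_nonneg c
    _ = (q : ℝ) ^ 2 / Fintype.card R := by
        simp only [Finset.sum_const, Finset.card_univ, Fintype.card_fin, nsmul_eq_mul, hc]
        push_cast
        field_simp

end UniqueAtom

/-- The inverse of (1 + 1/q)^q ≤ e. -/
theorem exp_neg_one_le_div_pow (q : ℕ) : Real.exp (-1) ≤ ((q : ℝ) / (q + 1)) ^ q := by
  rcases Nat.eq_zero_or_pos q with rfl | hq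
  · simp
  have hq' : (0 : ℝ) < q := by exact_mod_cast hq
  have h1 : ((q : ℝ) + 1) / q ≤ Real.exp (1 / q) := by
    have := Real.add_one_le_exp (1 / (q : ℝ))
    rwa [show (1 : ℝ) / q + 1 = (q + 1) / q by field_simp; ring] at this
  have h2 : (((q : ℝ) + 1) / q) ^ q ≤ Real.exp 1 := by
    calc _ ≤ Real.exp (1 / q) ^ q := by gcongr
      _ = Real.exp 1 := by rw [← Real.exp_nat_mul]; congr 1; field_simp
  rw [Real.exp_neg, ← inv_div, inv_pow]
  exact inv_anti₀ (by positivity) h2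

/-- The share hypergraph separates the distribution with the correct claims from the one with the
wrong claims. -/
theorem quarter_lt_freq_sub_freq {F V : Type*} [Field F] [Fintype F] [MeasurableSpace V]
    [MeasurableSingletonClass V] {q n : ℕ} (hn : 0 < n) [Fintype Fˣ]
    (hF : 10 * q ^ 2 ≤ Fintype.card Fˣ)
    {e : ShareVertex F → V} (he : Function.Injective e) {P : Fin n → Polynomial F}
    (hP : ∀ v, (P v).degree < q) {X : Fin n → F} (hX : ∀ v, X v ≠ (P v).eval 0)
    (hw : ∑ ω, shareWeights Fˣ q n ω = 1) :
    1 / 4 < freq (probMixture (shareWeights Fˣ q n) hw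
        (placement (e ∘ shareVertex P) (fun v b => e (claimVertex v b)) fun v => (P v).eval 0))
        (shareHypergraph q e) -
      freq (probMixture (shareWeights Fˣ q n) hw
        (placement (e ∘ shareVertex P) (fun v b => e (claimVertex v b)) X))
        (shareHypergraph q e) := by
  classical
  have hpl : ∀ Y : Fin n → F, ∀ t : Fin (q + 1) → Fˣ ⊕ Fin n,
      placement (e ∘ shareVertex P) (fun v b => e (claimVertex v b)) Y ∘ t =
        e ∘ (placement (shareVertex P) claimVertex Y ∘ t) := by
    intro Y t
    funext i
    rcases h : t i with u | v <;> simp [placement, h]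
  rw [freq_probMixture, freq_probMixture, ← Finset.sum_sub_distrib]
  -- With right claims every tuple with a unique random atom is an edge; with wrong claims an edge
  -- has a unique random atom and also a collision.
  have hterm : ∀ t : Fin (q + 1) → Fˣ ⊕ Fin n,
      (∏ i, (shareWeights Fˣ q n (t i) : ℝ)) *
          uniqueRandomAtoms.indicator 1 t -
        (∏ i, (shareWeights Fˣ q n (t i) : ℝ)) *
          collisions.indicator 1 t ≤
      (∏ i, (shareWeights Fˣ q n (t i) : ℝ)) * (shareHypergraph q e).edges.indicator 1
          (placement (e ∘ shareVertex P) (fun v b => e (claimVertex v b))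
            (fun v => (P v).eval 0) ∘ t) -
        (∏ i, (shareWeights Fˣ q n (t i) : ℝ)) * (shareHypergraph q e).edges.indicator 1
          (placement (e ∘ shareVertex P) (fun v b => e (claimVertex v b)) X ∘ t) := by
    intro t
    rw [← mul_sub, ← mul_sub]
    refine mul_le_mul_of_nonneg_left ?_ (Finset.prod_nonneg fun _ _ => NNReal.coe_nonneg _)
    simp only [hpl, Set.indicator_apply, Pi.one_apply, comp_mem_edges_shareHypergraph he]
    have h1 : (∃ i₀, HasUniqueRandomAtom t i₀) → IsShareEdge q
        (placement (shareVertex P) claimVertex (fun v => (P v).eval 0) ∘ t) :=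
      fun ⟨_, h⟩ => isShareEdge_of_hasUniqueRandomAtom hP h
    have h2 := exists_hasUniqueRandomAtom_of_isShareEdge (q := q) (P := P) (X := X) (t := t)
    have h3 : IsShareEdge q (placement (shareVertex P) claimVertex X ∘ t) → t ∈ collisions :=
      exists_ne_eq_inl_of_isShareEdge hP hX
    by_cases hA : t ∈ uniqueRandomAtoms
    · rw [if_pos hA, if_pos (h1 hA)]
      by_cases hB : IsShareEdge q (placement (shareVertex P) claimVertex X ∘ t)
      · rw [if_pos hB, if_pos (h3 hB)]
      · rw [if_neg hB]
        split_ifs <;> simp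
    · rw [if_neg hA, if_neg fun hB => hA (h2 hB)]
      split_ifs <;> simp
  have h1 := Finset.sum_le_sum fun t (_ : t ∈ Finset.univ) => hterm t
  rw [Finset.sum_sub_distrib] at h1
  have h2 := sum_weight_hasUniqueRandomAtom_ge (R := Fˣ) (q := q) hn
  have h3 := sum_weight_collision_le (R := Fˣ) (q := q) hn
  have h4 := exp_neg_one_le_div_pow q
  have h5 : (0.36 : ℝ) < Real.exp (-1) := by
    have := Real.exp_neg_one_gt_d9
    linarith
  have h6 : (q : ℝ) ^ 2 / Fintype.card Fˣ ≤ 1 / 10 := by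
    have hpos : (0 : ℝ) < Fintype.card Fˣ := by exact_mod_cast Fintype.card_pos
    rw [div_le_iff₀ hpos]
    have : (10 * q ^ 2 : ℝ) ≤ Fintype.card Fˣ := by exact_mod_cast hF
    linarith
  -- The numerical margin is 0.36 - 0.1 > 1/4.
  refine lt_of_lt_of_le ?_ h1
  linarith

/-! ### Secrecy of fewer than `r + 1` shares. -/

section SecretSharing

variable {F : Type*} [Field F] {r n : ℕ}

/-- The polynomials with the coefficient vectors `a 0, ..., a r`; their secrets are `a 0`. -/
def sharePolynomial (a : Fin (r + 1) → Fin n → F) (v : Fin n) : Polynomial F :=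
  ∑ j, Polynomial.C (a j v) * Polynomial.X ^ (j : ℕ)

theorem degree_sharePolynomial_lt (a : Fin (r + 1) → Fin n → F) (v : Fin n) :
    (sharePolynomial a v).degree < (r + 1 : ℕ) :=
  Polynomial.degree_sum_fin_lt _

theorem eval_sharePolynomial (a : Fin (r + 1) → Fin n → F) (v : Fin n) (x : F) :
    (sharePolynomial a v).eval x = ∑ j, a j v * x ^ (j : ℕ) := by
  simp [sharePolynomial, Polynomial.eval_finsetSum]

theorem eval_zero_sharePolynomial (a : Fin (r + 1) → Fin n → F) (v : Fin n) :
    (sharePolynomial a v).eval 0 = a 0 v := by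
  rw [eval_sharePolynomial, Fin.sum_univ_succ]
  simp

/-- At most `r` shares do not constrain the secret. -/
theorem exists_coeff_vanishing (S : Finset Fˣ) (hS : S.card < r + 1) :
    ∃ z : Fin (r + 1) → F, z 0 = 1 ∧ ∀ u ∈ S, ∑ j, z j * (u : F) ^ (j : ℕ) = 0 := by
  -- The product of 1 - X/u over `S` vanishes on `S` and is 1 at 0.
  set Q : Polynomial F := ∏ u ∈ S, (Polynomial.C (-((u⁻¹ : Fˣ) : F)) * Polynomial.X + 1) with hQ
  have hdeg : Q.natDegree < r + 1 := by
    refine lt_of_le_of_lt ?_ hS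
    refine (Polynomial.natDegree_prod_le _ _).trans ?_
    refine (Finset.sum_le_card_nsmul _ _ 1 fun u _ => ?_).trans (by simp)
    exact Polynomial.natDegree_linear_le
  refine ⟨fun j => Q.coeff j, ?_, fun u hu => ?_⟩
  · simp only [Fin.val_zero, Polynomial.coeff_zero_eq_eval_zero, hQ, Polynomial.eval_prod]
    simp
  · rw [Fin.sum_univ_eq_sum_range (fun j => Q.coeff j * (u : F) ^ j),
      ← Polynomial.eval_eq_sum_range' hdeg, hQ, Polynomial.eval_prod]
    refine Finset.prod_eq_zero hu ?_
    simp

end SecretSharing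

theorem IPM_singleton {k : ℕ} {V : Type*} [MeasurableSpace V] (g : Distinguisher k V)
    (p₁ p₂ : ProbabilityMeasure V) : IPM {g} p₁ p₂ = |freq p₁ g - freq p₂ g| := by
  simp only [IPM]
  rw [ciSup_unique]
  rfl

/-- A family that is translated by the elements of a finite group, with few bad translates of
each element, has few bad elements. -/
theorem sum_indicator_le_of_translates {A B : Type*} [AddGroup A] [Fintype A] [Fintype B]
    [Nonempty B] (bad : Set A) (s : B → A) {c : ℝ}
    (h : ∀ a, ∑ b, bad.indicator (1 : A → ℝ) (a + s b) ≤ c * Fintype.card B) :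
    ∑ a, bad.indicator (1 : A → ℝ) a ≤ c * Fintype.card A := by
  have h1 : (Fintype.card B : ℝ) * ∑ a, bad.indicator (1 : A → ℝ) a ≤
      Fintype.card B * (c * Fintype.card A) := by
    calc (Fintype.card B : ℝ) * ∑ a, bad.indicator (1 : A → ℝ) a
        = ∑ _b : B, ∑ a, bad.indicator (1 : A → ℝ) a := by simp
      _ = ∑ b : B, ∑ a, bad.indicator (1 : A → ℝ) (a + s b) :=
          Finset.sum_congr rfl fun b _ => (Equiv.sum_comp (Equiv.addRight (s b)) _).symm
      _ = ∑ a, ∑ b : B, bad.indicator (1 : A → ℝ) (a + s b) := Finset.sum_comm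
      _ ≤ ∑ _a : A, c * Fintype.card B := Finset.sum_le_sum fun a _ => h a
      _ = _ := by simp; ring
  exact le_of_mul_le_mul_left h1 (by exact_mod_cast Fintype.card_pos)

/-- The random atoms keep equal weights after conditioning, and their total is at most 1. -/
theorem restrictWeights_inr_mul_le {R : Type*} [Fintype R] [DecidableEq R] {q n : ℕ}
    (hpos : 0 < ∑ i, shareWeights R q n (Sum.inr i)) (S : Finset R) (i : Fin n) :
    (restrictWeights (shareWeights R q n) S (Sum.inr i) : ℝ) * n ≤ 1 := by
  have h := sum_restrictWeights hpos S
  rw [Fintype.sum_sum_type] at h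
  have h2 : ∑ j : Fin n, restrictWeights (shareWeights R q n) S (Sum.inr j) =
      restrictWeights (shareWeights R q n) S (Sum.inr i) * n := by
    have : ∀ j : Fin n, restrictWeights (shareWeights R q n) S (Sum.inr j) =
        restrictWeights (shareWeights R q n) S (Sum.inr i) := fun j => rfl
    rw [Finset.sum_congr rfl fun j _ => this j]
    simp [mul_comm]
  have h3 : restrictWeights (shareWeights R q n) S (Sum.inr i) * n ≤ 1 := by
    rw [← h2, ← h]; exact le_add_of_nonneg_left zero_le
  exact_mod_cast h3

/-- A property of the secrets and of fewer than `r + 1` shares that holds for few secrets, whatever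
the shares are, holds for few choices of the coefficients. -/
theorem sum_indicator_shares_le {F V : Type*} [Field F] [Fintype F] {r n : ℕ} {S : Finset Fˣ}
    (hS : S.card < r + 1) (e : ShareVertex F → V) (Q : (Fˣ → V) → (Fin n → F) → Prop)
    (hQ : ∀ y y' X, (∀ u ∈ S, y u = y' u) → (Q y X ↔ Q y' X)) {c : ℝ}
    (hc : ∀ y, (Nat.card {X | Q y X} : ℝ) ≤ c * (Fintype.card F : ℝ) ^ n) :
    ∑ a, {a : Fin (r + 1) → Fin n → F |
        Q (e ∘ shareVertex (sharePolynomial a)) (a 0)}.indicator (1 : (Fin (r + 1) → Fin n → F) → ℝ) a ≤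
      c * Fintype.card (Fin (r + 1) → Fin n → F) := by
  classical
  obtain ⟨z, hz0, hz⟩ := exists_coeff_vanishing S hS
  -- Translation by `z j * b v` keeps the shares in `S` and adds `b` to the secrets, so each family
  -- of translates runs over all secrets with these shares fixed.
  refine sum_indicator_le_of_translates (B := Fin n → F) _ (fun b j v => z j * b v) fun a => ?_
  set y : (Fin (r + 1) → Fin n → F) → Fˣ → V := fun a => e ∘ shareVertex (sharePolynomial a)
    with hy
  have hshift : ∀ b : Fin n → F, {a | Q (y a) (a 0)}.indicator
      (1 : (Fin (r + 1) → Fin n → F) → ℝ) (a + fun j v => z j * b v) =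
      if Q (y a) (a 0 + b) then 1 else 0 := by
    intro b
    set a' : Fin (r + 1) → Fin n → F := a + fun j v => z j * b v with ha'
    have ha0 : a' 0 = a 0 + b := by
      funext v; simp [ha', hz0]
    have hyS : ∀ u ∈ S, y a' u = y a u := by
      intro u hu
      simp only [hy, Function.comp, shareVertex]
      congr 4
      funext v
      rw [eval_sharePolynomial, eval_sharePolynomial]
      simp only [ha', Pi.add_apply, add_mul, Finset.sum_add_distrib, add_eq_left]
      have := congrArg (· * b v) (hz u hu)
      simp only [Finset.sum_mul, zero_mul] at this
      rw [← this]
      exact Finset.sum_congr rfl fun j _ => by ring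
    have hiff : a' ∈ {a | Q (y a) (a 0)} ↔ Q (y a) (a 0 + b) := by
      rw [Set.mem_ofPred_eq, ha0]
      exact hQ _ _ _ hyS
    rw [Set.indicator_apply, Pi.one_apply]
    exact if_congr hiff rfl rfl
  refine (Finset.sum_congr rfl fun b _ => hshift b).le.trans ?_
  refine (Equiv.sum_comp (Equiv.addLeft (a 0))
    (fun X => if Q (y a) X then (1 : ℝ) else 0)).le.trans ?_
  rw [← natCard_setOf_eq_sum, Fintype.card_fun, Fintype.card_fin, Nat.cast_pow]
  exact hc (y a)

/-! ### Choice of the polynomials and conclusion. -/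

/-- No discriminable class of `(r + 1)`-hypergraphs can replace the share hypergraph. -/
theorem exists_IPM_lt_and_quarter_lt_IPM {F V : Type} [Field F] [Fintype F] [MeasurableSpace V]
    [MeasurableSingletonClass V] {r : ℕ} [Fintype Fˣ] (hF : 10 * (r + 1) ^ 2 ≤ Fintype.card Fˣ)
    {e : ShareVertex F → V} (he : Function.Injective e) {H : Set (Distinguisher (r + 1) V)}
    (hH : Discriminable H) {ε : ℝ} (hε : 0 < ε) :
    ∃ p₁ p₂ : ProbabilityMeasure V,
      IPM H p₁ p₂ < ε ∧ 1 / 4 < IPM {shareHypergraph (r + 1) e} p₁ p₂ := by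
  classical
  by_contra hcon
  push Not at hcon
  set N := Fintype.card Fˣ with hN
  set L : ℝ := 2 ^ N * (2 * 2 ^ N) ^ N with hL
  have hLpos : 0 < L := by positivity
  -- Chosen so that L η = ε/2; likewise `c` makes the bad sets, over at most 2^N sets `S`, cover at
  -- most half of the coefficient choices.
  set η : ℝ := ε / (2 * L) with hη
  have hηpos : 0 < η := by positivity
  set c : ℝ := 1 / (2 * 2 ^ N) with hc
  -- The shift by 1 has no fixed point, so it makes every claim wrong.
  obtain ⟨n₀, hn₀⟩ := hH.card_le_IPM_placement_lt (Equiv.addRight (1 : F)) hηpos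
    (show 0 < c by positivity)
  set n := n₀ + 1 with hn
  have hnpos : 0 < n := Nat.succ_pos _
  set w := shareWeights Fˣ (r + 1) n with hw
  have hw1 : ∑ ω, w ω = 1 := sum_shareWeights _ _ hnpos
  have hpos : 0 < ∑ i, w (Sum.inr i) := by
    rw [hw, sum_shareWeights_inr _ _ hnpos]; positivity
  set l : Fin n → F → V := fun v b => e (claimVertex v b) with hl
  set y : (Fin (r + 1) → Fin n → F) → Fˣ → V := fun a => e ∘ shareVertex (sharePolynomial a)
    with hy
  set Q : Finset Fˣ → (Fˣ → V) → (Fin n → F) → Prop := fun S y X =>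
    η ≤ IPM H (probMixture (restrictWeights w S) (sum_restrictWeights hpos S) (placement y l X))
      (probMixture (restrictWeights w S) (sum_restrictWeights hpos S)
        (placement y l (Equiv.addRight (1 : F) ∘ X))) with hQ
  set bad : Finset Fˣ → Set (Fin (r + 1) → Fin n → F) := fun S => {a | Q S (y a) (a 0)} with hbad
  -- Coefficients outside all bad sets would give a pair with small IPM for `H` and gap above 1/4,
  -- against `hcon`.
  have hall : ∀ a, ∃ S : Finset Fˣ, S.card < r + 1 ∧ a ∈ bad S := by
    intro a
    by_contra hno
    push Not at hno
    have hsmall := IPM_placement_le_of_restrictWeights (Nat.succ_pos r) H hw1 hpos (y a) l (a 0)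
      (Equiv.addRight (1 : F) ∘ a 0) (η := η) fun S hS => (not_le.1 (hno S hS)).le
    have hlt : IPM H (probMixture w hw1 (placement (y a) l (a 0)))
        (probMixture w hw1 (placement (y a) l (Equiv.addRight (1 : F) ∘ a 0))) < ε := by
      refine hsmall.trans_lt ?_
      change L * η < ε
      have : L * η = ε / 2 := by rw [hη]; field_simp
      linarith
    have hle := hcon _ _ hlt
    rw [IPM_singleton] at hle
    have hgap := quarter_lt_freq_sub_freq hnpos hF he (degree_sharePolynomial_lt a)
      (X := Equiv.addRight (1 : F) ∘ a 0) (fun v => by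
        rw [eval_zero_sharePolynomial]; simp) hw1
    have h0 : (fun v => (sharePolynomial a v).eval 0) = a 0 :=
      funext (eval_zero_sharePolynomial a)
    rw [h0] at hgap
    exact absurd (hgap.trans_le (le_abs_self _)) (not_lt.2 hle)
  have hfew : ∀ S : Finset Fˣ, S.card < r + 1 → ∑ a, (bad S).indicator (1 : (Fin (r + 1) → Fin n → F) → ℝ) a ≤
      c * Fintype.card (Fin (r + 1) → Fin n → F) := by
    intro S hS
    refine sum_indicator_shares_le hS e (Q S) (fun y y' X hyy => ?_) fun y => ?_
    · have hmix : ∀ X, probMixture (restrictWeights w S) (sum_restrictWeights hpos S)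
          (placement y l X) = probMixture (restrictWeights w S) (sum_restrictWeights hpos S)
          (placement y' l X) := by
        intro X
        refine probMixture_congr _ fun ω hω => ?_
        rcases ω with u | v
        · have hu : u ∈ S := by
            by_contra hu
            exact hω (by simp [restrictWeights, maskWeights, hu])
          exact hyy u hu
        · simp only [placement, Sum.elim_inr]
      simp only [hQ, hmix]
    · exact (hn₀ n (Nat.le_succ _) Fˣ (restrictWeights w S) (sum_restrictWeights hpos S)
        (restrictWeights_inr_mul_le hpos S) y l).le
  set A := Fintype.card (Fin (r + 1) → Fin n → F) with hA
  have hApos : (0 : ℝ) < A := by exact_mod_cast Fintype.card_pos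
  have hcount : (A : ℝ) ≤ 2 ^ N * (c * A) := by
    calc (A : ℝ) = ∑ _a : Fin (r + 1) → Fin n → F, 1 := by simp [hA]
      _ ≤ ∑ a, ∑ S : Finset Fˣ with S.card < r + 1, (bad S).indicator (1 : (Fin (r + 1) → Fin n → F) → ℝ) a := by
          refine Finset.sum_le_sum fun a _ => ?_
          obtain ⟨S, hS, haS⟩ := hall a
          have h1 : (bad S).indicator (1 : (Fin (r + 1) → Fin n → F) → ℝ) a = 1 := Set.indicator_of_mem haS _
          rw [← h1]
          exact Finset.single_le_sum (f := fun S => (bad S).indicator (1 : (Fin (r + 1) → Fin n → F) → ℝ) a)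
            (fun S _ => Set.indicator_nonneg (fun _ _ => zero_le_one) _)
            (Finset.mem_filter.2 ⟨Finset.mem_univ S, hS⟩)
      _ = ∑ S : Finset Fˣ with S.card < r + 1, ∑ a, (bad S).indicator (1 : (Fin (r + 1) → Fin n → F) → ℝ) a :=
          Finset.sum_comm
      _ ≤ ∑ S : Finset Fˣ with S.card < r + 1, c * A :=
          Finset.sum_le_sum fun S hS => hfew S (Finset.mem_filter.1 hS).2
      _ ≤ ∑ _S : Finset Fˣ, c * A :=
          Finset.sum_le_sum_of_subset_of_nonneg (Finset.filter_subset _ _)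
            fun _ _ _ => by positivity
      _ = 2 ^ N * (c * A) := by
          rw [Finset.sum_const, Finset.card_univ, Fintype.card_finset, nsmul_eq_mul]
          push_cast
          rfl
  have hhalf : (2 : ℝ) ^ N * (c * A) = A / 2 := by rw [hc]; field_simp
  linarith

/-- A class with a single element is discriminated without any sample. -/
theorem hasSampleComplexity_singleton {k : ℕ} {V : Type*} [MeasurableSpace V]
    (g : Distinguisher k V) : HasSampleComplexity {g} fun _ _ => 0 := by
  refine ⟨fun _ _ _ _ => ⟨g, rfl⟩, fun ε δ hε hδ _ m₁ m₂ _ _ p₁ p₂ => ?_⟩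
  have huniv : {S : (Fin m₁ → V) × (Fin m₂ → V) |
      IPM {g} p₁ p₂ - ε < |freq p₁ g - freq p₂ g|} = Set.univ := by
    rw [IPM_singleton]
    exact Set.eq_univ_of_forall fun _ => sub_lt_self _ hε
  change 1 - δ ≤ Measure.real _ {S : (Fin m₁ → V) × (Fin m₂ → V) |
      IPM {g} p₁ p₂ - ε < |freq p₁ g - freq p₂ g|}
  rw [huniv, probReal_univ]
  linarith

end GraphDiscriminator

end

theorem mainTheorem4 :
    ∃ C : ℝ, 0 < C ∧ ∀ k : ℕ, 2 ≤ k →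
      ∃ G : Set (GraphDiscriminator.Distinguisher k ℕ),
        (∃ m : ℝ → ℝ → ℕ, GraphDiscriminator.HasSampleComplexity G m ∧
          ∀ ε δ : ℝ, 0 < ε → 0 < δ → δ < 1 →
            (m ε δ : ℝ) ≤ C * (((k : ℝ) ^ 2 + Real.log (1 / δ)) / ε ^ 2)) ∧
        ∀ H : Set (GraphDiscriminator.Distinguisher (k - 1) ℕ),
          GraphDiscriminator.Discriminable H →
            ∀ ε : ℝ, 0 < ε →
              ∃ p₁ p₂ : MeasureTheory.ProbabilityMeasure ℕ,
                GraphDiscriminator.IPM H p₁ p₂ < ε ∧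
                  1 / 4 < GraphDiscriminator.IPM G p₁ p₂ := by
  -- A single hypergraph suffices, so that no sample is needed.
  refine ⟨1, one_pos, fun k hk => ?_⟩
  obtain ⟨r, rfl⟩ : ∃ r, k = r + 2 := ⟨k - 2, by omega⟩
  -- Then the field has p - 1 ≥ 10q² units, where q = r + 1 = k - 1.
  obtain ⟨p, hpge, hp⟩ := Nat.exists_infinite_primes (10 * (r + 1) ^ 2 + 1)
  have : Fact p.Prime := ⟨hp⟩
  -- The shares are lists of arbitrary length, so one countable vertex set, hence one hypergraph,
  -- works for all `n`, and so for all `H` and ε.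
  obtain ⟨e, he⟩ := exists_injective_nat (GraphDiscriminator.ShareVertex (ZMod p))
  refine ⟨{GraphDiscriminator.shareHypergraph (r + 1) e}, ⟨fun _ _ => 0,
    GraphDiscriminator.hasSampleComplexity_singleton _, fun ε δ hε hδ hδ1 => ?_⟩,
    fun H hH ε hε => ?_⟩
  · have : 0 ≤ Real.log (1 / δ) := Real.log_nonneg (by rw [le_div_iff₀ hδ]; linarith)
    rw [Nat.cast_zero]
    positivity
  · exact GraphDiscriminator.exists_IPM_lt_and_quarter_lt_IPM (r := r)
      (by rw [ZMod.card_units]; omega) he hH hε
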